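/- Let $(M,g)$ be a Lorentz surface (a smooth 2-manifold with a metric of index $1$) with Levi-Civita connection $\nabla$ and curvature $R$. Let $(\tilde M,\tilde g,J)$ be a Lorentzian Kaehler surface: a smooth manifold of real dimension $4$ with an almost complex structure $J$ and an indefinite metric $\tilde g$ such that $\tilde g(JX,JY)=\tilde g(X,Y)$ and $\tilde\nabla J=0$ for the Levi-Civita connection $\tilde\nabla$ of $\tilde g$, and such that the largest $J$-invariant negative definite subspace of each tangent space has complex dimension $1$. Let $\tilde R$ be its curvature. The convention is $R(X,Y)=[\nabla_X,\nabla_Y]-\nabla_{[X,Y]}$. Let $f:M\to\tilde M$ be smooth, let $V\to M$ be a smooth vector bundle of rank $2$, and let $\tau:TM\to f^*T\tilde M$ and $\nu:V\to f^*T\tilde M$ be smooth bundle maps such that $\tilde g(\tau X,\tau Y)=g(X,Y)$, $\nu$ is injective and $\nu(V)\perp\tau(TM)$; thus $f^*T\tilde M=\tau(TM)\oplus\nu(V)$. Given a connection $\hat\nabla$ on $f^*T\tilde M$, let $h$, $A$, $D$ (smooth, $D$ being a connection on $V$) satisfy the formulas of Gauss and Weingarten $$\hat\nabla_X(\tau Y)=\tau(\nabla_XY)+\nu\,h(X,Y),\qquad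 \hat\nabla_X(\nu\xi)=-\tau(A_\xi X)+\nu\,D_X\xi .$$ Write $\langle\xi,\eta\rangle=\tilde g(\nu\xi,\nu\eta)$ and identify tangent vectors $X$ and $\xi\in V$ with $\tau X$ and $\nu\xi$ where they enter $\tilde R$ and $\tilde g$. Consider at a point $x\in M$ the equations of Gauss, Codazzi and Ricci, for all $X,Y,Z,W\in T_xM$ and $\xi,\eta\in V_x$: $$g(R(X,Y)Z,W)=\tilde g(\tilde R(X,Y)Z,W)+\langle h(X,W),h(Y,Z)\rangle-\langle h(X,Z),h(Y,W)\rangle ,\tag{G}$$ $$(\tilde R(X,Y)Z)^\perp=(\bar\nabla_Xh)(Y,Z)-(\bar\nabla_Yh)(X,Z),\tag{C}$$ $$\langle R^D(X,Y)\xi,\eta\rangle=\tilde g(\tilde R(X,Y)\xi,\eta)+g([A_\xi,A_\eta]X,Y),\tag{R}$$ where $R^D$ is the curvature of $D$, $(\cdot)^\perp$ is the component in $V$, and $(\bar\nabla_Xh)(Y,Z)=D_Xh(Y,Z)-h(\nabla_XY,Z)-h(Y,\nabla_XZ)$. The equation of Gauss is a consequence of the equations of Codazzi and Ricci, in both of the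 following situations. (1) $f$ is an isometric immersion with $\tau=df$ (so $V$ is its normal bundle) and $\hat\nabla=f^*\tilde\nabla$ (so $h$, $A$, $D$ are its second fundamental form, shape operator and normal connection): at every point $x\in M$, if (C) and (R) hold at $x$, then (G) holds at $x$. (2) More generally, $\tau$ is arbitrary as above, and $\hat\nabla$ is any connection on $f^*T\tilde M$, not necessarily induced by $\tilde\nabla$, which is metric, satisfies $\hat\nabla J=0$, and is torsion free in the sense that $\hat\nabla_X(\tau Y)-\hat\nabla_Y(\tau X)=\tau[X,Y]$: at every point $x\in M$, if (C) and (R) hold at $x$, then (G) holds at $x$. -/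

import Mathlib

open Bundle
open scoped Manifold ContDiff Topology

noncomputable section

namespace LorentzKaehler

section Connections

variable {E : Type*} [NormedAddCommGroup E] [NormedSpace ℝ E]
  {H : Type*} [TopologicalSpace H] {I : ModelWithCorners ℝ E H}
  {M : Type*} [TopologicalSpace M] [ChartedSpace H M] [IsManifold I ∞ M]

/-- The vector field `X` is smooth at the point `x`. -/
def SmoothFieldAt (X : Π x : M, TangentSpace I x) (x : M) : Prop :=
  ContMDiffAt I (I.prod 𝓘(ℝ, E)) ∞ (fun y ↦ (⟨y, X y⟩ : TangentBundle I M)) x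

section Bundle

variable (F : Type*) [NormedAddCommGroup F] [NormedSpace ℝ F]
  {V : M → Type*} [TopologicalSpace (TotalSpace F V)]
  [∀ x, AddCommGroup (V x)] [∀ x, Module ℝ (V x)] [∀ x, TopologicalSpace (V x)]
  [∀ x, IsTopologicalAddGroup (V x)] [∀ x, ContinuousSMul ℝ (V x)]
  [FiberBundle F V]

variable (I) in
/-- The section `σ` of the vector bundle `V` is smooth at the point `x`. -/
def SmoothSectionAt (σ : Π x : M, V x) (x : M) : Prop :=
  ContMDiffAt I (I.prod 𝓘(ℝ, F)) ∞ (fun y ↦ (⟨y, σ y⟩ : TotalSpace F V)) x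

variable {F}

/-- A connection is smooth if `∇_X σ` is smooth wherever `X` and `σ` are.
Recall that `∇ σ x u` is `∇_u σ` at the point `x`. -/
def IsSmoothConnection (nabla : CovariantDerivative I F V) : Prop :=
  ∀ (σ : Π x : M, V x) (X : Π x : M, TangentSpace I x) (x : M),
    SmoothSectionAt I F σ x → SmoothFieldAt X x →
      SmoothSectionAt I F (fun y ↦ nabla σ y (X y)) x

/-- `∇_X ∇_Y σ - ∇_Y ∇_X σ - ∇_{[X,Y]} σ`. -/
def curvatureField (nabla : CovariantDerivative I F V) (X Y : Π x : M, TangentSpace I x)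
    (σ : Π x : M, V x) (x : M) : V x :=
  nabla (fun y ↦ nabla σ y (Y y)) x (X x) - nabla (fun y ↦ nabla σ y (X y)) x (Y x)
    - nabla σ x (VectorField.mlieBracket I X Y x)

/-- The curvature tensor `R(u, v) s` of a connection at the point `x`, computed by extending the
vectors `u, v, s` at `x` to local smooth sections. -/
def curvature (nabla : CovariantDerivative I F V) (x : M) (u v : TangentSpace I x) (s : V x) :
    V x :=
  curvatureField nabla (FiberBundle.extend E u) (FiberBundle.extend E v)
    (FiberBundle.extend F s) x

end Bundle

/-- A (possibly indefinite) semi-Riemannian metric: a smooth field of nondegenerate symmetric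
bilinear forms on the tangent spaces. -/
structure IsSemiRiemannianMetric
    (g : Π x : M, TangentSpace I x →L[ℝ] TangentSpace I x →L[ℝ] ℝ) : Prop where
  symm : ∀ x (u v : TangentSpace I x), g x u v = g x v u
  nondegenerate : ∀ x (u : TangentSpace I x), (∀ v, g x u v = 0) → u = 0
  smooth : ContMDiff I (I.prod 𝓘(ℝ, E →L[ℝ] E →L[ℝ] ℝ)) ∞
    (fun x ↦ TotalSpace.mk' (E →L[ℝ] E →L[ℝ] ℝ) x (g x))

/-- The form `g` at `x` is negative definite on the subspace `W`. -/
def IsNegativeDefiniteOn (g : Π x : M, TangentSpace I x →L[ℝ] TangentSpace I x →L[ℝ] ℝ) (x : M)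
    (W : Submodule ℝ (TangentSpace I x)) : Prop :=
  ∀ v ∈ W, v ≠ 0 → g x v v < 0

/-- A Lorentzian metric: a semi-Riemannian metric of index one. -/
structure IsLorentzMetric
    (g : Π x : M, TangentSpace I x →L[ℝ] TangentSpace I x →L[ℝ] ℝ) : Prop
    extends IsSemiRiemannianMetric g where
  index_one : ∀ x, IsGreatest {d : ℕ | ∃ W : Submodule ℝ (TangentSpace I x),
    IsNegativeDefiniteOn g x W ∧ Module.finrank ℝ W = d} 1

/-- `∇` is the Levi-Civita connection of `g`: smooth, torsion free and metric. -/
structure IsLeviCivita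
    (g : Π x : M, TangentSpace I x →L[ℝ] TangentSpace I x →L[ℝ] ℝ)
    (nabla : CovariantDerivative I E (TangentSpace I : M → Type _)) : Prop where
  smooth : IsSmoothConnection nabla
  torsion_free : ∀ (X Y : Π x : M, TangentSpace I x) (x : M),
    SmoothFieldAt X x → SmoothFieldAt Y x →
      nabla Y x (X x) - nabla X x (Y x) = VectorField.mlieBracket I X Y x
  metric : ∀ (Y Z : Π x : M, TangentSpace I x) (x : M), SmoothFieldAt Y x → SmoothFieldAt Z x →
    ∀ u : TangentSpace I x, mvfderiv I (fun y ↦ g y (Y y) (Z y)) x u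
      = g x (nabla Y x u) (Z x) + g x (Y x) (nabla Z x u)

/-- `(g, J)` is an indefinite Kaehler structure of complex index one, where `∇` is
the Levi-Civita connection of `g`. -/
structure IsLorentzianKaehler
    (g : Π x : M, TangentSpace I x →L[ℝ] TangentSpace I x →L[ℝ] ℝ)
    (J : Π x : M, TangentSpace I x →L[ℝ] TangentSpace I x)
    (nabla : CovariantDerivative I E (TangentSpace I : M → Type _)) : Prop where
  metric : IsSemiRiemannianMetric g
  smooth : ContMDiff I (I.prod 𝓘(ℝ, E →L[ℝ] E)) ∞ (fun x ↦ TotalSpace.mk' (E →L[ℝ] E) x (J x))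
  almost_complex : ∀ x (u : TangentSpace I x), J x (J x u) = -u
  hermitian : ∀ x (u v : TangentSpace I x), g x (J x u) (J x v) = g x u v
  levi_civita : IsLeviCivita g nabla
  parallel : ∀ (Y : Π x : M, TangentSpace I x) (x : M), SmoothFieldAt Y x →
    ∀ u : TangentSpace I x, nabla (fun y ↦ J y (Y y)) x u = J x (nabla Y x u)
  complex_index_one : ∀ x, IsGreatest {d : ℕ | ∃ W : Submodule ℝ (TangentSpace I x),
    (∀ v ∈ W, J x v ∈ W) ∧ IsNegativeDefiniteOn g x W ∧ Module.finrank ℝ W = 2 * d} 1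

end Connections

section Surfaces

/-- The model space of real dimension `n`. -/
abbrev R (n : ℕ) : Type := EuclideanSpace ℝ (Fin n)

variable {M : Type*} [TopologicalSpace M] [ChartedSpace (R 2) M] [IsManifold (𝓡 2) ∞ M]
  {N : Type*} [TopologicalSpace N] [ChartedSpace (R 4) N] [IsManifold (𝓡 4) ∞ N]
  {V : M → Type*} [TopologicalSpace (TotalSpace (R 2) V)]
  [∀ x, AddCommGroup (V x)] [∀ x, Module ℝ (V x)] [∀ x, TopologicalSpace (V x)]
  [∀ x, IsTopologicalAddGroup (V x)] [∀ x, ContinuousSMul ℝ (V x)]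
  [FiberBundle (R 2) V]

/-- The vector field `s` along the map `f : M → N` is smooth at `x`. -/
def SmoothAlongAt (f : M → N) (s : Π x : M, TangentSpace (𝓡 4) (f x)) (x : M) : Prop :=
  ContMDiffAt (𝓡 2) ((𝓡 4).prod 𝓘(ℝ, R 4)) ∞
    (fun y ↦ (⟨f y, s y⟩ : TangentBundle (𝓡 4) N)) x

/-- An isometric splitting `TM ⊕ V = f^*TN` along a smooth map `f : M → N`: `τ` embeds `TM`
isometrically, and `ν` identifies `V`, which has rank two, with the orthogonal complement of
`τ (TM)`. When `τ` is the differential of `f`, this says that `f` is an isometric immersion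
with normal bundle `V`. -/
structure IsSplitting (g : Π x : M, TangentSpace (𝓡 2) x →L[ℝ] TangentSpace (𝓡 2) x →L[ℝ] ℝ)
    (gN : Π y : N, TangentSpace (𝓡 4) y →L[ℝ] TangentSpace (𝓡 4) y →L[ℝ] ℝ)
    (f : M → N) (τ : Π x : M, TangentSpace (𝓡 2) x →L[ℝ] TangentSpace (𝓡 4) (f x))
    (ν : Π x : M, V x →L[ℝ] TangentSpace (𝓡 4) (f x)) : Prop where
  smooth_map : ContMDiff (𝓡 2) (𝓡 4) ∞ f
  smooth_tangent : ∀ (X : Π x : M, TangentSpace (𝓡 2) x) (x : M), SmoothFieldAt X x →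
    SmoothAlongAt f (fun y ↦ τ y (X y)) x
  smooth_normal : ∀ (ξ : Π x : M, V x) (x : M), SmoothSectionAt (𝓡 2) (R 2) ξ x →
    SmoothAlongAt f (fun y ↦ ν y (ξ y)) x
  isometric : ∀ x (u v : TangentSpace (𝓡 2) x), gN (f x) (τ x u) (τ x v) = g x u v
  orthogonal : ∀ x (u : TangentSpace (𝓡 2) x) (ξ : V x), gN (f x) (τ x u) (ν x ξ) = 0
  injective : ∀ x, Function.Injective (ν x)

/-- A smooth connection on `f^*TN`; `nab s x u` is the covariant derivative at `x`
in the direction `u` of the vector field `s` along `f`. -/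
structure IsConnectionAlong (f : M → N)
    (nab : (Π x : M, TangentSpace (𝓡 4) (f x)) →
      Π x : M, TangentSpace (𝓡 2) x →L[ℝ] TangentSpace (𝓡 4) (f x)) : Prop where
  add : ∀ (s t : Π x : M, TangentSpace (𝓡 4) (f x)) (x : M),
    SmoothAlongAt f s x → SmoothAlongAt f t x →
      nab (fun y ↦ s y + t y) x = nab s x + nab t x
  leibniz : ∀ (φ : M → ℝ) (s : Π x : M, TangentSpace (𝓡 4) (f x)) (x : M),
    ContMDiffAt (𝓡 2) 𝓘(ℝ, ℝ) ∞ φ x → SmoothAlongAt f s x →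
      ∀ u : TangentSpace (𝓡 2) x,
        nab (fun y ↦ φ y • s y) x u = φ x • nab s x u + mvfderiv (𝓡 2) φ x u • s x
  smooth : ∀ (s : Π x : M, TangentSpace (𝓡 4) (f x)) (X : Π x : M, TangentSpace (𝓡 2) x) (x : M),
    SmoothAlongAt f s x → SmoothFieldAt X x → SmoothAlongAt f (fun y ↦ nab s y (X y)) x

/-- `nab` is the connection on `f^*TN` induced by the connection `nablaN` of `N`. -/
structure IsPullbackConnection (nablaN : CovariantDerivative (𝓡 4) (R 4)
      (TangentSpace (𝓡 4) : N → Type _)) (f : M → N)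
    (nab : (Π x : M, TangentSpace (𝓡 4) (f x)) →
      Π x : M, TangentSpace (𝓡 2) x →L[ℝ] TangentSpace (𝓡 4) (f x)) : Prop
    extends IsConnectionAlong f nab where
  comp : ∀ (Z : Π y : N, TangentSpace (𝓡 4) y) (x : M), SmoothFieldAt Z (f x) →
    ∀ u : TangentSpace (𝓡 2) x,
      nab (fun y ↦ Z (f y)) x u = nablaN Z (f x) (mfderiv (𝓡 2) (𝓡 4) f x u)

/-- A Kaehler connection on `f^*TN`: metric, with `J` parallel, and torsion free with respect to
`τ : TM → f^*TN`. It is *not* required to be induced by the connection of `N`. -/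
structure IsKaehlerConnectionAlong
    (gN : Π y : N, TangentSpace (𝓡 4) y →L[ℝ] TangentSpace (𝓡 4) y →L[ℝ] ℝ)
    (J : Π y : N, TangentSpace (𝓡 4) y →L[ℝ] TangentSpace (𝓡 4) y)
    (f : M → N) (τ : Π x : M, TangentSpace (𝓡 2) x →L[ℝ] TangentSpace (𝓡 4) (f x))
    (nab : (Π x : M, TangentSpace (𝓡 4) (f x)) →
      Π x : M, TangentSpace (𝓡 2) x →L[ℝ] TangentSpace (𝓡 4) (f x)) : Prop
    extends IsConnectionAlong f nab where
  metric : ∀ (s t : Π x : M, TangentSpace (𝓡 4) (f x)) (x : M),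
    SmoothAlongAt f s x → SmoothAlongAt f t x → ∀ u : TangentSpace (𝓡 2) x,
      mvfderiv (𝓡 2) (fun y ↦ gN (f y) (s y) (t y)) x u
        = gN (f x) (nab s x u) (t x) + gN (f x) (s x) (nab t x u)
  parallel : ∀ (s : Π x : M, TangentSpace (𝓡 4) (f x)) (x : M), SmoothAlongAt f s x →
    ∀ u : TangentSpace (𝓡 2) x, nab (fun y ↦ J (f y) (s y)) x u = J (f x) (nab s x u)
  torsion_free : ∀ (X Y : Π x : M, TangentSpace (𝓡 2) x) (x : M),
    SmoothFieldAt X x → SmoothFieldAt Y x →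
      nab (fun y ↦ τ y (Y y)) x (X x) - nab (fun y ↦ τ y (X y)) x (Y x)
        = τ x (VectorField.mlieBracket (𝓡 2) X Y x)

/-- The formulas of Gauss and Weingarten, which decompose the connection `nab` of `f^*TN` into the
connection `nabla` of `M`, the second fundamental form `h`, the shape operator `A`
(`A x ξ u` is `A_ξ u`) and the normal connection `D`. -/
structure GaussWeingarten
    (nabla : CovariantDerivative (𝓡 2) (R 2) (TangentSpace (𝓡 2) : M → Type _))
    (f : M → N) (τ : Π x : M, TangentSpace (𝓡 2) x →L[ℝ] TangentSpace (𝓡 4) (f x))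
    (ν : Π x : M, V x →L[ℝ] TangentSpace (𝓡 4) (f x))
    (nab : (Π x : M, TangentSpace (𝓡 4) (f x)) →
      Π x : M, TangentSpace (𝓡 2) x →L[ℝ] TangentSpace (𝓡 4) (f x))
    (h : Π x : M, TangentSpace (𝓡 2) x →L[ℝ] TangentSpace (𝓡 2) x →L[ℝ] V x)
    (A : Π x : M, V x →L[ℝ] TangentSpace (𝓡 2) x →L[ℝ] TangentSpace (𝓡 2) x)
    (D : CovariantDerivative (𝓡 2) (R 2) V) : Prop where
  smooth_h : ∀ (X Y : Π x : M, TangentSpace (𝓡 2) x) (x : M),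
    SmoothFieldAt X x → SmoothFieldAt Y x →
      SmoothSectionAt (𝓡 2) (R 2) (fun y ↦ h y (X y) (Y y)) x
  smooth_A : ∀ (ξ : Π x : M, V x) (X : Π x : M, TangentSpace (𝓡 2) x) (x : M),
    SmoothSectionAt (𝓡 2) (R 2) ξ x → SmoothFieldAt X x →
      SmoothFieldAt (fun y ↦ A y (ξ y) (X y)) x
  smooth_D : IsSmoothConnection D
  gauss : ∀ (Y : Π x : M, TangentSpace (𝓡 2) x) (x : M), SmoothFieldAt Y x →
    ∀ u : TangentSpace (𝓡 2) x,
      nab (fun y ↦ τ y (Y y)) x u = τ x (nabla Y x u) + ν x (h x u (Y x))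
  weingarten : ∀ (ξ : Π x : M, V x) (x : M), SmoothSectionAt (𝓡 2) (R 2) ξ x →
    ∀ u : TangentSpace (𝓡 2) x,
      nab (fun y ↦ ν y (ξ y)) x u = -τ x (A x (ξ x) u) + ν x (D ξ x u)

/-- `(∇̄_u h)(v, w) = D_u h(v, w) - h(∇_u v, w) - h(v, ∇_u w)` at `x`, where `v` and `w` are
extended to local smooth vector fields. -/
def covDerivSecondForm
    (nabla : CovariantDerivative (𝓡 2) (R 2) (TangentSpace (𝓡 2) : M → Type _))
    (h : Π x : M, TangentSpace (𝓡 2) x →L[ℝ] TangentSpace (𝓡 2) x →L[ℝ] V x)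
    (D : CovariantDerivative (𝓡 2) (R 2) V) (x : M) (u v w : TangentSpace (𝓡 2) x) : V x :=
  D (fun y ↦ h y (FiberBundle.extend (R 2) v y) (FiberBundle.extend (R 2) w y)) x u
    - h x (nabla (FiberBundle.extend (R 2) v) x u) w
    - h x v (nabla (FiberBundle.extend (R 2) w) x u)

/-- The equation of Gauss at the point `x`. -/
def GaussEquationAt (g : Π x : M, TangentSpace (𝓡 2) x →L[ℝ] TangentSpace (𝓡 2) x →L[ℝ] ℝ)
    (nabla : CovariantDerivative (𝓡 2) (R 2) (TangentSpace (𝓡 2) : M → Type _))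
    (gN : Π y : N, TangentSpace (𝓡 4) y →L[ℝ] TangentSpace (𝓡 4) y →L[ℝ] ℝ)
    (nablaN : CovariantDerivative (𝓡 4) (R 4) (TangentSpace (𝓡 4) : N → Type _))
    (f : M → N) (τ : Π x : M, TangentSpace (𝓡 2) x →L[ℝ] TangentSpace (𝓡 4) (f x))
    (ν : Π x : M, V x →L[ℝ] TangentSpace (𝓡 4) (f x))
    (h : Π x : M, TangentSpace (𝓡 2) x →L[ℝ] TangentSpace (𝓡 2) x →L[ℝ] V x) (x : M) : Prop :=
  ∀ X Y Z W : TangentSpace (𝓡 2) x,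
    g x (curvature nabla x X Y Z) W
      = gN (f x) (curvature nablaN (f x) (τ x X) (τ x Y) (τ x Z)) (τ x W)
        + gN (f x) (ν x (h x X W)) (ν x (h x Y Z))
        - gN (f x) (ν x (h x X Z)) (ν x (h x Y W))

/-- The equation of Codazzi at the point `x`: the component in `V` of `R̃(X, Y) Z` is
`(∇̄_X h)(Y, Z) - (∇̄_Y h)(X, Z)`, that is, they differ by a tangent vector. -/
def CodazziEquationAt
    (nabla : CovariantDerivative (𝓡 2) (R 2) (TangentSpace (𝓡 2) : M → Type _))
    (nablaN : CovariantDerivative (𝓡 4) (R 4) (TangentSpace (𝓡 4) : N → Type _))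
    (f : M → N) (τ : Π x : M, TangentSpace (𝓡 2) x →L[ℝ] TangentSpace (𝓡 4) (f x))
    (ν : Π x : M, V x →L[ℝ] TangentSpace (𝓡 4) (f x))
    (h : Π x : M, TangentSpace (𝓡 2) x →L[ℝ] TangentSpace (𝓡 2) x →L[ℝ] V x)
    (D : CovariantDerivative (𝓡 2) (R 2) V) (x : M) : Prop :=
  ∀ X Y Z : TangentSpace (𝓡 2) x, ∃ T : TangentSpace (𝓡 2) x,
    curvature nablaN (f x) (τ x X) (τ x Y) (τ x Z)
      = τ x T + ν x (covDerivSecondForm nabla h D x X Y Z - covDerivSecondForm nabla h D x Y X Z)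

/-- The equation of Ricci at the point `x`. -/
def RicciEquationAt (g : Π x : M, TangentSpace (𝓡 2) x →L[ℝ] TangentSpace (𝓡 2) x →L[ℝ] ℝ)
    (gN : Π y : N, TangentSpace (𝓡 4) y →L[ℝ] TangentSpace (𝓡 4) y →L[ℝ] ℝ)
    (nablaN : CovariantDerivative (𝓡 4) (R 4) (TangentSpace (𝓡 4) : N → Type _))
    (f : M → N) (τ : Π x : M, TangentSpace (𝓡 2) x →L[ℝ] TangentSpace (𝓡 4) (f x))
    (ν : Π x : M, V x →L[ℝ] TangentSpace (𝓡 4) (f x))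
    (A : Π x : M, V x →L[ℝ] TangentSpace (𝓡 2) x →L[ℝ] TangentSpace (𝓡 2) x)
    (D : CovariantDerivative (𝓡 2) (R 2) V) (x : M) : Prop :=
  ∀ (X Y : TangentSpace (𝓡 2) x) (ξ η : V x),
    gN (f x) (ν x (curvature D x X Y ξ)) (ν x η)
      = gN (f x) (curvature nablaN (f x) (τ x X) (τ x Y) (ν x ξ)) (ν x η)
        + g x (A x ξ (A x η X) - A x η (A x ξ X)) Y

end Surfaces

end LorentzKaehler

end

/-!
The curvature operators `R̂` of the connection on `f^*TN` and `R̃` of `N`, evaluated on two tangent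
vectors of `M` at `x`, are skew-adjoint and commute with `J`, hence so does `L = R̂ - R̃`. By the
Gauss and Weingarten formulas the three equations say that components of `L` vanish: Codazzi the
one from `T = τ (T_x M)` to `T^⊥`, Ricci the one from `T^⊥` to itself, Gauss the one from `T` to
itself. The first two leave an `L` that vanishes on `T^⊥` and preserves `T`. The Lorentz plane `T`
is not complex, as it has no room for orthogonal timelike vectors `u` and `J u`; so some `J ξ` with
`ξ ∈ T^⊥` has a tangential part `u ≠ 0`, and `L u = L (J ξ) = J (L ξ) = 0`. A skew form on a plane
with nonzero kernel vanishes, so `L = 0` on `T`, which is the equation of Gauss.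
-/

namespace LorentzKaehler

section Extend

variable {E : Type*} [NormedAddCommGroup E] [NormedSpace ℝ E]
  {H : Type*} [TopologicalSpace H] {I : ModelWithCorners ℝ E H}
  {M : Type*} [TopologicalSpace M] [ChartedSpace H M]
  {F : Type*} [NormedAddCommGroup F] [NormedSpace ℝ F]
  {W : M → Type*} [TopologicalSpace (TotalSpace F W)]
  [∀ x, AddCommGroup (W x)] [∀ x, Module ℝ (W x)] [∀ x, TopologicalSpace (W x)]
  [FiberBundle F W] [VectorBundle ℝ F W] [ContMDiffVectorBundle ∞ F W I]

theorem eventually_smoothSectionAt_extend {x : M} (w : W x) :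
    ∀ᶠ y in 𝓝 x, SmoothSectionAt I F (FiberBundle.extend F w) y := by
  obtain ⟨s, hs, hsmooth⟩ := FiberBundle.exists_contMDiffOn_extend (k := ∞) I F w
  filter_upwards [eventually_mem_nhds_iff.2 hs] with y hy using hsmooth.contMDiffAt hy

end Extend

theorem exists_eventually_eq_one_smul_eq {M : Type*} [TopologicalSpace M] {V : M → Type*}
    [∀ y, AddCommGroup (V y)] [∀ y, Module ℝ (V y)] {s t : Π y : M, V y} {x : M}
    (h : ∀ᶠ y in 𝓝 x, s y = t y) :
    ∃ ψ : M → ℝ, ψ =ᶠ[𝓝 x] (fun _ ↦ 1) ∧ (fun y ↦ ψ y • s y) = fun y ↦ ψ y • t y := by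
  classical
  refine ⟨fun y ↦ if s y = t y then 1 else 0, h.mono fun y hy ↦ if_pos hy, funext fun y ↦ ?_⟩
  by_cases hy : s y = t y <;> simp [hy]

section SectionsAlong

variable {E : Type*} [NormedAddCommGroup E] [NormedSpace ℝ E]
  {H : Type*} [TopologicalSpace H] {I : ModelWithCorners ℝ E H}
  {M : Type*} [TopologicalSpace M] [ChartedSpace H M]
  {E' : Type*} [NormedAddCommGroup E'] [NormedSpace ℝ E']
  {H' : Type*} [TopologicalSpace H'] {I' : ModelWithCorners ℝ E' H'}
  {N : Type*} [TopologicalSpace N] [ChartedSpace H' N]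
  {F : Type*} [NormedAddCommGroup F] [NormedSpace ℝ F]
  {W : N → Type*} [TopologicalSpace (TotalSpace F W)] [∀ y, TopologicalSpace (W y)]
  [FiberBundle F W]
  {f : M → N} {s t : Π x : M, W (f x)} {φ : M → ℝ} {x : M}

variable (I I' F) in
/-- The section `s` of the vector bundle `W` along the map `f`, that is, of the pullback of `W`
by `f`, is smooth at `x`. It is encoded as a map to the total space of `W` so that no charts of the
pullback bundle are needed; for `f = id` this is `SmoothSectionAt`. -/
def SmoothSectionAlongAt (f : M → N) (s : Π x : M, W (f x)) (x : M) : Prop :=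
  ContMDiffAt I (I'.prod 𝓘(ℝ, F)) ∞ (fun y ↦ (⟨f y, s y⟩ : TotalSpace F W)) x

theorem SmoothSectionAlongAt.congr (hs : SmoothSectionAlongAt I I' F f s x)
    (h : ∀ᶠ y in 𝓝 x, t y = s y) : SmoothSectionAlongAt I I' F f t x :=
  ContMDiffAt.congr_of_eventuallyEq hs (h.mono fun y hy ↦ by simp only [hy])

theorem SmoothSectionAlongAt.contMDiffAt_base (hs : SmoothSectionAlongAt I I' F f s x) :
    ContMDiffAt I I' ∞ f x :=
  (contMDiffAt_totalSpace.1 hs).1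

theorem SmoothSectionAt.comp {Z : Π y : N, W y} (hZ : SmoothSectionAt I' F Z (f x))
    (hf : ContMDiffAt I I' ∞ f x) : SmoothSectionAlongAt I I' F f (fun y ↦ Z (f y)) x :=
  ContMDiffAt.comp x hZ hf

variable [∀ y, AddCommGroup (W y)] [∀ y, Module ℝ (W y)]
  {A : Type*} [AddCommGroup A] [Module ℝ A] {Φ : (Π x : M, W (f x)) → A}

variable (I I' F) in
/-- The operation `Φ` on sections along `f` is linear over the functions that are smooth at `x`;
this is the counterpart for sections along a map of `TensorialAt`. -/
structure TensorialAlongAt (Φ : (Π x : M, W (f x)) → A) (x : M) : Prop where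
  add : ∀ {s t : Π x : M, W (f x)}, SmoothSectionAlongAt I I' F f s x →
    SmoothSectionAlongAt I I' F f t x → Φ (fun y ↦ s y + t y) = Φ s + Φ t
  smul : ∀ {φ : M → ℝ} {s : Π x : M, W (f x)}, ContMDiffAt I 𝓘(ℝ, ℝ) ∞ φ x →
    SmoothSectionAlongAt I I' F f s x → Φ (fun y ↦ φ y • s y) = φ x • Φ s

theorem TensorialAlongAt.congr (hΦ : TensorialAlongAt I I' F Φ x)
    (hs : SmoothSectionAlongAt I I' F f s x) (ht : SmoothSectionAlongAt I I' F f t x)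
    (h : ∀ᶠ y in 𝓝 x, s y = t y) : Φ s = Φ t := by
  obtain ⟨ψ, hψ, hst⟩ := exists_eventually_eq_one_smul_eq h
  have hψs : ContMDiffAt I 𝓘(ℝ, ℝ) ∞ ψ x := contMDiffAt_const.congr_of_eventuallyEq hψ
  have := hΦ.smul hψs hs
  rw [hst, hΦ.smul hψs ht] at this
  simpa [hψ.self_of_nhds] using this.symm

variable [VectorBundle ℝ F W]

theorem eventually_smoothSectionAlongAt_extend [ContMDiffVectorBundle ∞ F W I']
    (hf : ContMDiff I I' ∞ f) (w : W (f x)) :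
    ∀ᶠ y in 𝓝 x, SmoothSectionAlongAt I I' F f (fun y ↦ FiberBundle.extend F w (f y)) y := by
  filter_upwards [(hf x).continuousAt.eventually
    (eventually_smoothSectionAt_extend (I := I') (F := F) w)] with y hy using hy.comp (hf y)

theorem SmoothSectionAlongAt.exists_comp_eq [ContMDiffVectorBundle ∞ F W I']
    (hs : SmoothSectionAlongAt I I' F f s x) :
    ∃ Z : Π y : N, W y, SmoothSectionAt I' F Z (f x) ∧
      SmoothSectionAlongAt I I' F f (fun y ↦ Z (f y)) x ∧ s x = Z (f x) := by
  have hZ : SmoothSectionAt I' F (FiberBundle.extend F (s x)) (f x) :=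
    (eventually_smoothSectionAt_extend (s x)).self_of_nhds
  exact ⟨_, hZ, hZ.comp hs.contMDiffAt_base, by simp⟩

theorem smoothSectionAlongAt_iff :
    SmoothSectionAlongAt I I' F f s x ↔ ContMDiffAt I I' ∞ f x ∧
      ContMDiffAt I 𝓘(ℝ, F) ∞
        (fun y ↦ (trivializationAt F W (f x)).continuousLinearMapAt ℝ (f y) (s y)) x := by
  rw [SmoothSectionAlongAt, contMDiffAt_totalSpace]
  refine and_congr_right fun hf ↦ Filter.EventuallyEq.contMDiffAt_iff ?_
  filter_upwards [hf.continuousAt.eventually_mem ((trivializationAt F W (f x)).open_baseSet.mem_nhds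
    (FiberBundle.mem_baseSet_trivializationAt' _))] with y hy
  rw [Trivialization.continuousLinearMapAt_apply, Trivialization.linearMapAt_apply, if_pos hy]

theorem SmoothSectionAlongAt.zero (hf : ContMDiffAt I I' ∞ f x) :
    SmoothSectionAlongAt I I' F f (fun y ↦ (0 : W (f y))) x := by
  rw [smoothSectionAlongAt_iff]
  simpa only [map_zero] using ⟨hf, contMDiffAt_const⟩

theorem SmoothSectionAlongAt.add (hs : SmoothSectionAlongAt I I' F f s x)
    (ht : SmoothSectionAlongAt I I' F f t x) :
    SmoothSectionAlongAt I I' F f (fun y ↦ s y + t y) x := by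
  rw [smoothSectionAlongAt_iff] at *
  simpa only [map_add] using ⟨hs.1, hs.2.add ht.2⟩

theorem SmoothSectionAlongAt.smul (hφ : ContMDiffAt I 𝓘(ℝ, ℝ) ∞ φ x)
    (hs : SmoothSectionAlongAt I I' F f s x) :
    SmoothSectionAlongAt I I' F f (fun y ↦ φ y • s y) x := by
  rw [smoothSectionAlongAt_iff] at *
  simpa only [map_smul] using ⟨hs.1, hφ.smul hs.2⟩

theorem SmoothSectionAlongAt.neg (hs : SmoothSectionAlongAt I I' F f s x) :
    SmoothSectionAlongAt I I' F f (fun y ↦ - s y) x := by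
  simpa only [neg_smul, one_smul] using hs.smul (φ := fun _ ↦ (-1 : ℝ)) contMDiffAt_const

theorem SmoothSectionAlongAt.sum (hf : ContMDiffAt I I' ∞ f x) {ι : Type*} (T : Finset ι)
    {σ : ι → Π x : M, W (f x)} (hσ : ∀ i, SmoothSectionAlongAt I I' F f (σ i) x) :
    SmoothSectionAlongAt I I' F f (fun y ↦ ∑ i ∈ T, σ i y) x := by
  classical
  induction T using Finset.induction_on with
  | empty => simpa only [Finset.sum_empty] using .zero hf
  | insert a T ha ih => simpa only [Finset.sum_insert ha] using (hσ a).add ih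

theorem SmoothSectionAlongAt.bilin {g : Π y : N, W y →L[ℝ] W y →L[ℝ] ℝ}
    (hg : ContMDiff I' (I'.prod 𝓘(ℝ, F →L[ℝ] F →L[ℝ] ℝ)) ∞
      (fun y ↦ TotalSpace.mk' (F →L[ℝ] F →L[ℝ] ℝ) (E := fun y ↦ W y →L[ℝ] W y →L[ℝ] ℝ) y (g y)))
    (hs : SmoothSectionAlongAt I I' F f s x) (ht : SmoothSectionAlongAt I I' F f t x) :
    ContMDiffAt I 𝓘(ℝ, ℝ) ∞ (fun y ↦ g (f y) (s y) (t y)) x := by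
  have h : ContMDiffAt I (I'.prod 𝓘(ℝ, ℝ)) ∞
      (fun m ↦ TotalSpace.mk' ℝ (E := Bundle.Trivial N ℝ) (f m) (g (f m) (s m) (t m))) x :=
    ContMDiffAt.clm_bundle_apply₂ ((hg (f x)).comp x hs.contMDiffAt_base) hs ht
  exact (contMDiffAt_totalSpace.1 h).2

theorem SmoothSectionAlongAt.endo [∀ y, IsTopologicalAddGroup (W y)] [∀ y, ContinuousSMul ℝ (W y)]
    {J : Π y : N, W y →L[ℝ] W y}
    (hJ : ContMDiff I' (I'.prod 𝓘(ℝ, F →L[ℝ] F)) ∞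
      (fun y ↦ TotalSpace.mk' (F →L[ℝ] F) (E := fun y ↦ W y →L[ℝ] W y) y (J y)))
    (hs : SmoothSectionAlongAt I I' F f s x) :
    SmoothSectionAlongAt I I' F f (fun y ↦ J (f y) (s y)) x :=
  ContMDiffAt.clm_bundle_apply ((hJ (f x)).comp x hs.contMDiffAt_base) hs

theorem TensorialAlongAt.sum_smul (hΦ : TensorialAlongAt I I' F Φ x) (hf : ContMDiffAt I I' ∞ f x)
    {ι : Type*} (T : Finset ι) {c : ι → M → ℝ} {σ : ι → Π x : M, W (f x)}
    (hc : ∀ i, ContMDiffAt I 𝓘(ℝ, ℝ) ∞ (c i) x) (hσ : ∀ i, SmoothSectionAlongAt I I' F f (σ i) x) :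
    Φ (fun y ↦ ∑ i ∈ T, c i y • σ i y) = ∑ i ∈ T, c i x • Φ (σ i) := by
  classical
  induction T using Finset.induction_on with
  | empty =>
    simpa using hΦ.smul (φ := fun _ ↦ 0) (s := fun y ↦ (0 : W (f y))) contMDiffAt_const (.zero hf)
  | insert a T ha ih =>
    simp only [Finset.sum_insert ha]
    rw [hΦ.add ((hσ a).smul (hc a)) (.sum hf T fun i ↦ (hσ i).smul (hc i)), ih,
      hΦ.smul (hc a) (hσ a)]

theorem TensorialAlongAt.pointwise [ContMDiffVectorBundle ∞ F W I'] [FiniteDimensional ℝ F]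
    (hΦ : TensorialAlongAt I I' F Φ x) (hs : SmoothSectionAlongAt I I' F f s x)
    (ht : SmoothSectionAlongAt I I' F f t x) (hst : s x = t x) : Φ s = Φ t := by
  let b := Module.finBasis ℝ F
  let e := trivializationAt F W (f x)
  have hf := hs.contMDiffAt_base
  have hx : f x ∈ e.baseSet := FiberBundle.mem_baseSet_trivializationAt' _
  have hframe (i) : SmoothSectionAlongAt I I' F f (fun y ↦ e.localFrame b i (f y)) x :=
    SmoothSectionAt.comp (contMDiffAt_localFrame_of_mem _ e b i hx) hf
  have expand {s : Π x : M, W (f x)} (hs : SmoothSectionAlongAt I I' F f s x) :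
      Φ s = ∑ i, b.repr (e.continuousLinearMapAt ℝ (f x) (s x)) i •
        Φ (fun y ↦ e.localFrame b i (f y)) := by
    have hcoeff (i) : ContMDiffAt I 𝓘(ℝ, ℝ) ∞
        (fun y ↦ b.repr (e.continuousLinearMapAt ℝ (f y) (s y)) i) x :=
      (b.coord i).toContinuousLinearMap.contMDiff.contMDiffAt.comp x
        (smoothSectionAlongAt_iff.1 hs).2
    rw [← hΦ.sum_smul hf _ hcoeff hframe]
    refine hΦ.congr hs (.sum hf _ fun i ↦ (hframe i).smul (hcoeff i)) ?_
    filter_upwards [hf.continuousAt.eventually_mem (e.open_baseSet.mem_nhds hx)] with y hy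
    calc s y = e.symmL ℝ (f y) (e.continuousLinearMapAt ℝ (f y) (s y)) :=
          (e.symmL_continuousLinearMapAt hy (s y)).symm
      _ = e.symmL ℝ (f y) (∑ i, b.repr (e.continuousLinearMapAt ℝ (f y) (s y)) i • b i) := by
          rw [b.sum_repr]
      _ = _ := by
          simp only [map_sum, map_smul]
          simp only [e.symmL_apply hy, e.localFrame_apply_of_mem_baseSet b hy,
            Trivialization.basisAt, Module.Basis.map_apply,
            Trivialization.linearEquivAt_symm_apply]
  rw [expand hs, expand ht, hst]

end SectionsAlong

section Fields

variable {E : Type*} [NormedAddCommGroup E] [NormedSpace ℝ E]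
  {H : Type*} [TopologicalSpace H] {I : ModelWithCorners ℝ E H}
  {M : Type*} [TopologicalSpace M] [ChartedSpace H M]
  {φ : M → ℝ} {X Y Z : Π x : M, TangentSpace I x} {x : M}

theorem mvfderiv_congr_of_eventuallyEq {ψ : M → ℝ} (h : φ =ᶠ[𝓝 x] ψ) :
    mvfderiv I φ x = mvfderiv I ψ x := by
  ext u
  exact DFunLike.congr_fun (h.mfderiv_eq (I := I) (I' := 𝓘(ℝ, ℝ))) u

variable {E' : Type*} [NormedAddCommGroup E'] [NormedSpace ℝ E']
  {H' : Type*} [TopologicalSpace H'] {I' : ModelWithCorners ℝ E' H'}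
  {N : Type*} [TopologicalSpace N] [ChartedSpace H' N] [IsManifold I' ∞ N]

theorem SmoothSectionAlongAt.mvfderiv_apply {f : M → N} {s : Π y : M, TangentSpace I' (f y)}
    {φ : N → ℝ} (hφ : ContMDiffAt I' 𝓘(ℝ, ℝ) ∞ φ (f x))
    (hs : SmoothSectionAlongAt I I' E' f s x) :
    ContMDiffAt I 𝓘(ℝ, ℝ) ∞ (fun y ↦ mvfderiv I' φ (f y) (s y)) x := by
  have : IsManifold I' 1 N := IsManifold.of_le (n := ∞) (by simp)
  have hf := hs.contMDiffAt_base
  have h : ContMDiffAt I (𝓘(ℝ, ℝ).prod 𝓘(ℝ, ℝ)) ∞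
      (fun y ↦ (⟨φ (f y), mfderiv I' 𝓘(ℝ, ℝ) φ (f y) (s y)⟩ : TangentBundle 𝓘(ℝ, ℝ) ℝ)) x :=
    ContMDiffAt.clm_apply_of_inCoordinates
      ((hφ.mfderiv_const (m := ∞) (by simp)).comp x hf) hs (hφ.comp x hf)
  exact (contMDiff_snd_tangentBundle_modelSpace ℝ 𝓘(ℝ, ℝ)).contMDiffAt.comp x h

variable [IsManifold I ∞ M]

theorem SmoothFieldAt.mdifferentiableAt (hX : SmoothFieldAt X x) :
    MDifferentiableAt I (I.prod 𝓘(ℝ, E)) (fun y ↦ (⟨y, X y⟩ : TangentBundle I M)) x :=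
  ContMDiffAt.mdifferentiableAt hX (by simp)

theorem SmoothFieldAt.mlieBracket [CompleteSpace E] (hX : SmoothFieldAt X x)
    (hY : SmoothFieldAt Y x) : SmoothFieldAt (VectorField.mlieBracket I X Y) x := by
  have : IsManifold I (minSmoothness ℝ 2) M :=
    IsManifold.of_le (n := ∞) (by simpa using (ENat.LEInfty.out : (2 : WithTop ℕ∞) ≤ ∞))
  have : IsManifold I (((⊤ : ℕ∞) : WithTop ℕ∞) + 1) M := IsManifold.of_le (n := ∞) (by simp)
  exact ContMDiffAt.mlieBracket_vectorField (m := ⊤) (n := ⊤) hX hY (by simp)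

theorem smoothSectionAlongAt_mfderiv {f : M → N} (hf : ContMDiffAt I I' ∞ f x)
    (hX : SmoothFieldAt X x) :
    SmoothSectionAlongAt I I' E' f (fun y ↦ mfderiv I I' f y (X y)) x := by
  have : IsManifold I 1 M := IsManifold.of_le (n := ∞) (by simp)
  have : IsManifold I' 1 N := IsManifold.of_le (n := ∞) (by simp)
  exact ContMDiffAt.clm_apply_of_inCoordinates (hf.mfderiv_const (m := ∞) (by simp)) hX hf

theorem mlieBracket_mlieBracket_smul_right [CompleteSpace E]
    (hφ : ∀ᶠ y in 𝓝 x, ContMDiffAt I 𝓘(ℝ, ℝ) ∞ φ y) (hY : SmoothFieldAt Y x)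
    (hZ : ∀ᶠ y in 𝓝 x, SmoothFieldAt Z y) :
    VectorField.mlieBracket I X (VectorField.mlieBracket I Y (φ • Z)) x
      = mvfderiv I (fun y ↦ mvfderiv I φ y (Y y)) x (X x) • Z x
        + mvfderiv I φ x (Y x) • VectorField.mlieBracket I X Z x
        + (mvfderiv I φ x (X x) • VectorField.mlieBracket I Y Z x
          + φ x • VectorField.mlieBracket I X (VectorField.mlieBracket I Y Z) x) := by
  have hφx := hφ.self_of_nhds
  have hZx := hZ.self_of_nhds
  have hYφ := SmoothSectionAlongAt.mvfderiv_apply (f := fun y ↦ y) hφx hY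
  have hYZ := hY.mlieBracket hZx
  have leibniz : VectorField.mlieBracket I Y (φ • Z) =ᶠ[𝓝 x]
      (fun y ↦ mvfderiv I φ y (Y y)) • Z + φ • VectorField.mlieBracket I Y Z := by
    filter_upwards [hφ, hZ] with y hφy hZy
    exact VectorField.mlieBracket_smul_right (hφy.mdifferentiableAt (by simp))
      hZy.mdifferentiableAt
  rw [Filter.EventuallyEq.mlieBracket_vectorField_eq (Filter.EventuallyEq.refl _ X) leibniz,
    VectorField.mlieBracket_add_right
      (ContMDiffAt.mdifferentiableAt (hYφ.smul_section hZx) (by simp))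
      (ContMDiffAt.mdifferentiableAt (hφx.smul_section hYZ) (by simp)),
    VectorField.mlieBracket_smul_right (hYφ.mdifferentiableAt (by simp)) hZx.mdifferentiableAt,
    VectorField.mlieBracket_smul_right (hφx.mdifferentiableAt (by simp)) hYZ.mdifferentiableAt]

/- Both sides are the coefficient of `Z` when the Jacobi identity for `X`, `Y`, `φ • Z` is expanded
by the Leibniz rule, `Z` being any field that does not vanish at `x`. -/
theorem mvfderiv_mlieBracket [CompleteSpace E] (hφ : ∀ᶠ y in 𝓝 x, ContMDiffAt I 𝓘(ℝ, ℝ) ∞ φ y)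
    (hX : SmoothFieldAt X x) (hY : SmoothFieldAt Y x) :
    mvfderiv I φ x (VectorField.mlieBracket I X Y x)
      = mvfderiv I (fun y ↦ mvfderiv I φ y (Y y)) x (X x)
        - mvfderiv I (fun y ↦ mvfderiv I φ y (X y)) x (Y x) := by
  have : IsManifold I (minSmoothness ℝ 3) M :=
    IsManifold.of_le (n := ∞) (by simpa using (ENat.LEInfty.out : (3 : WithTop ℕ∞) ≤ ∞))
  have le2 : minSmoothness ℝ 2 ≤ ∞ := by simpa using (ENat.LEInfty.out : (2 : WithTop ℕ∞) ≤ ∞)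
  rcases subsingleton_or_nontrivial (TangentSpace I x) with hE | hE
  · simp [Subsingleton.elim _ (0 : TangentSpace I x)]
  obtain ⟨z, hz⟩ := exists_ne (0 : TangentSpace I x)
  obtain ⟨Z, hZ, rfl⟩ : ∃ Z : Π y : M, TangentSpace I y,
      (∀ᶠ y in 𝓝 x, SmoothFieldAt Z y) ∧ Z x = z :=
    ⟨_, eventually_smoothSectionAt_extend z, by simp⟩
  have hφx := hφ.self_of_nhds
  have hZx := hZ.self_of_nhds
  have jacobi {U : Π y : M, TangentSpace I y} (hU : SmoothFieldAt U x) :=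
    VectorField.leibniz_identity_mlieBracket_apply (ContMDiffAt.of_le hX le2)
      (ContMDiffAt.of_le hY le2) (ContMDiffAt.of_le hU le2)
  have jacobi_smul := jacobi (hφx.smul_section hZx)
  rw [mlieBracket_mlieBracket_smul_right hφ hY hZ,
    mlieBracket_mlieBracket_smul_right hφ hX hZ,
    VectorField.mlieBracket_smul_right (hφx.mdifferentiableAt (by simp)) hZx.mdifferentiableAt,
    jacobi hZx, smul_add] at jacobi_smul
  suffices h : mvfderiv I φ x (VectorField.mlieBracket I X Y x) • Z x = _ • Z x from
    smul_left_injective ℝ hz h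
  rw [sub_smul, eq_comm, ← sub_eq_zero, ← sub_eq_zero.2 jacobi_smul]
  abel

end Fields

section ConnectionsAlong

variable {E : Type*} [NormedAddCommGroup E] [NormedSpace ℝ E]
  {H : Type*} [TopologicalSpace H] {I : ModelWithCorners ℝ E H}
  {M : Type*} [TopologicalSpace M] [ChartedSpace H M] [IsManifold I ∞ M]
  {E' : Type*} [NormedAddCommGroup E'] [NormedSpace ℝ E']
  {H' : Type*} [TopologicalSpace H'] {I' : ModelWithCorners ℝ E' H'}
  {N : Type*} [TopologicalSpace N] [ChartedSpace H' N]
  {F : Type*} [NormedAddCommGroup F] [NormedSpace ℝ F]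
  {W : N → Type*} [TopologicalSpace (TotalSpace F W)]
  [∀ y, AddCommGroup (W y)] [∀ y, Module ℝ (W y)] [∀ y, TopologicalSpace (W y)]
  [∀ y, IsTopologicalAddGroup (W y)] [FiberBundle F W]

variable (I I' F) in
/-- A smooth connection on the pullback of the vector bundle `W` by `f`: `nab s x u` is the
covariant derivative at `x` in the direction `u` of the section `s` along `f`. The case `f = id`
is that of a smooth connection on `W` itself, so that the same curvature identities serve the
tangent, normal and ambient bundles. -/
structure IsBundleConnectionAlong (f : M → N)
    (nab : (Π x : M, W (f x)) → Π x : M, TangentSpace I x →L[ℝ] W (f x)) : Prop where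
  add : ∀ (s t : Π x : M, W (f x)) (x : M),
    SmoothSectionAlongAt I I' F f s x → SmoothSectionAlongAt I I' F f t x →
      nab (fun y ↦ s y + t y) x = nab s x + nab t x
  leibniz : ∀ (φ : M → ℝ) (s : Π x : M, W (f x)) (x : M),
    ContMDiffAt I 𝓘(ℝ, ℝ) ∞ φ x → SmoothSectionAlongAt I I' F f s x →
      ∀ u : TangentSpace I x,
        nab (fun y ↦ φ y • s y) x u = φ x • nab s x u + mvfderiv I φ x u • s x
  smooth : ∀ (s : Π x : M, W (f x)) (X : Π x : M, TangentSpace I x) (x : M),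
    SmoothSectionAlongAt I I' F f s x → SmoothFieldAt X x →
      SmoothSectionAlongAt I I' F f (fun y ↦ nab s y (X y)) x

variable {f : M → N} {nab : (Π x : M, W (f x)) → Π x : M, TangentSpace I x →L[ℝ] W (f x)}
  {s t : Π x : M, W (f x)} {x : M} {X Y : Π x : M, TangentSpace I x}

theorem IsBundleConnectionAlong.congr (hnab : IsBundleConnectionAlong I I' F f nab)
    (hs : SmoothSectionAlongAt I I' F f s x) (h : ∀ᶠ y in 𝓝 x, t y = s y) :
    nab t x = nab s x := by
  obtain ⟨ψ, hψ, hst⟩ := exists_eventually_eq_one_smul_eq h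
  have hψs : ContMDiffAt I 𝓘(ℝ, ℝ) ∞ ψ x := contMDiffAt_const.congr_of_eventuallyEq hψ
  have hψx : ψ x = 1 := hψ.self_of_nhds
  have hdψ : mvfderiv I ψ x = 0 := by
    rw [mvfderiv_congr_of_eventuallyEq hψ, mvfderiv_const]
  ext u
  have leibniz := hnab.leibniz ψ t x hψs (hs.congr h) u
  rw [hst, hnab.leibniz ψ s x hψs hs u] at leibniz
  simpa [hψx, hdψ] using leibniz.symm

theorem IsBundleConnectionAlong.neg (hnab : IsBundleConnectionAlong I I' F f nab)
    (hs : SmoothSectionAlongAt I I' F f s x) : nab (fun y ↦ - s y) x = - nab s x := by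
  ext u
  simpa [mvfderiv_const] using hnab.leibniz (fun _ ↦ -1) s x contMDiffAt_const hs u

variable (I I' F) in
/-- A smooth connection on the pullback of `W` by `f` for which the field of bilinear forms `g`
and the field of endomorphisms `J` of `W` are parallel. -/
structure IsCompatibleConnectionAlong [∀ y, ContinuousSMul ℝ (W y)]
    (g : Π y : N, W y →L[ℝ] W y →L[ℝ] ℝ) (J : Π y : N, W y →L[ℝ] W y) (f : M → N)
    (nab : (Π x : M, W (f x)) → Π x : M, TangentSpace I x →L[ℝ] W (f x)) : Prop
    extends IsBundleConnectionAlong I I' F f nab where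
  metric : ∀ (s t : Π x : M, W (f x)) (x : M), SmoothSectionAlongAt I I' F f s x →
    SmoothSectionAlongAt I I' F f t x → ∀ u : TangentSpace I x,
      mvfderiv I (fun y ↦ g (f y) (s y) (t y)) x u
        = g (f x) (nab s x u) (t x) + g (f x) (s x) (nab t x u)
  parallel : ∀ (s : Π x : M, W (f x)) (x : M), SmoothSectionAlongAt I I' F f s x →
    ∀ u : TangentSpace I x, nab (fun y ↦ J (f y) (s y)) x u = J (f x) (nab s x u)

/-- The curvature `∇_X ∇_Y s - ∇_Y ∇_X s - ∇_{[X,Y]} s` of a connection on the pullback of `W` by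
`f`. -/
noncomputable def curvatureAlong
    (nab : (Π x : M, W (f x)) → Π x : M, TangentSpace I x →L[ℝ] W (f x))
    (X Y : Π x : M, TangentSpace I x) (s : Π x : M, W (f x)) (x : M) : W (f x) :=
  nab (fun y ↦ nab s y (Y y)) x (X x) - nab (fun y ↦ nab s y (X y)) x (Y x)
    - nab s x (VectorField.mlieBracket I X Y x)

namespace IsCompatibleConnectionAlong

variable [∀ y, ContinuousSMul ℝ (W y)] [VectorBundle ℝ F W]
  {g : Π y : N, W y →L[ℝ] W y →L[ℝ] ℝ} {J : Π y : N, W y →L[ℝ] W y}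

/- `[X, Y]` applied to the function `g(s, t)`: the mixed terms `g(∇_X s, ∇_Y t)` are symmetric
in `X` and `Y` up to exchanging the two slots, and cancel. -/
theorem bilin_curvatureAlong [CompleteSpace E] (hnab : IsCompatibleConnectionAlong I I' F g J f nab)
    (hg : ContMDiff I' (I'.prod 𝓘(ℝ, F →L[ℝ] F →L[ℝ] ℝ)) ∞
      (fun y ↦ TotalSpace.mk' (F →L[ℝ] F →L[ℝ] ℝ) (E := fun y ↦ W y →L[ℝ] W y →L[ℝ] ℝ) y (g y)))
    (hX : SmoothFieldAt X x) (hY : SmoothFieldAt Y x)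
    (hs : ∀ᶠ y in 𝓝 x, SmoothSectionAlongAt I I' F f s y)
    (ht : ∀ᶠ y in 𝓝 x, SmoothSectionAlongAt I I' F f t y) :
    g (f x) (curvatureAlong nab X Y s x) (t x)
      = - g (f x) (s x) (curvatureAlong nab X Y t x) := by
  have hsx := hs.self_of_nhds
  have htx := ht.self_of_nhds
  have second_derivative (Z : Π x : M, TangentSpace I x) (hZ : SmoothFieldAt Z x)
      (u : TangentSpace I x) :
      mvfderiv I (fun y ↦ mvfderiv I (fun y ↦ g (f y) (s y) (t y)) y (Z y)) x u
        = (g (f x) (nab (fun y ↦ nab s y (Z y)) x u) (t x) + g (f x) (nab s x (Z x)) (nab t x u))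
        + (g (f x) (nab s x u) (nab t x (Z x))
          + g (f x) (s x) (nab (fun y ↦ nab t y (Z y)) x u)) := by
    have hZs := hnab.smooth s Z x hsx hZ
    have hZt := hnab.smooth t Z x htx hZ
    have first_derivative : (fun y ↦ mvfderiv I (fun y ↦ g (f y) (s y) (t y)) y (Z y)) =ᶠ[𝓝 x]
        fun y ↦ g (f y) (nab s y (Z y)) (t y) + g (f y) (s y) (nab t y (Z y)) := by
      filter_upwards [hs, ht] with y hsy hty using hnab.metric s t y hsy hty _
    rw [mvfderiv_congr_of_eventuallyEq first_derivative, ← hnab.metric _ _ x hZs htx,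
      ← hnab.metric _ _ x hsx hZt, ← add_apply,
      ← mvfderiv_fun_add ((hZs.bilin hg htx).mdifferentiableAt (by simp))
        ((hsx.bilin hg hZt).mdifferentiableAt (by simp))]
  have bracket := mvfderiv_mlieBracket (φ := fun y ↦ g (f y) (s y) (t y)) (x := x)
    (by filter_upwards [hs, ht] with y hsy hty using hsy.bilin hg hty) hX hY
  rw [second_derivative Y hY, second_derivative X hX, hnab.metric _ _ x hsx htx] at bracket
  simp only [curvatureAlong, map_sub, sub_apply]
  linarith

theorem curvatureAlong_endo (hnab : IsCompatibleConnectionAlong I I' F g J f nab)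
    (hJ : ContMDiff I' (I'.prod 𝓘(ℝ, F →L[ℝ] F)) ∞
      (fun y ↦ TotalSpace.mk' (F →L[ℝ] F) (E := fun y ↦ W y →L[ℝ] W y) y (J y)))
    (hX : SmoothFieldAt X x) (hY : SmoothFieldAt Y x)
    (hs : ∀ᶠ y in 𝓝 x, SmoothSectionAlongAt I I' F f s y) :
    curvatureAlong nab X Y (fun y ↦ J (f y) (s y)) x = J (f x) (curvatureAlong nab X Y s x) := by
  have hsx := hs.self_of_nhds
  have second_derivative (Z : Π x : M, TangentSpace I x) (hZ : SmoothFieldAt Z x)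
      (u : TangentSpace I x) :
      nab (fun y ↦ nab (fun y ↦ J (f y) (s y)) y (Z y)) x u
        = J (f x) (nab (fun y ↦ nab s y (Z y)) x u) := by
    have hZs := hnab.smooth s Z x hsx hZ
    rw [← hnab.parallel _ x hZs, hnab.congr (hZs.endo hJ)]
    filter_upwards [hs] with y hy using hnab.parallel s y hy _
  simp only [curvatureAlong, second_derivative X hX, second_derivative Y hY,
    hnab.parallel s x hsx, map_sub]

/- Skew-adjointness of the curvature for a nondegenerate `g` already forces it to be tensorial. -/
theorem exists_curvatureEnd [CompleteSpace E] [ContMDiffVectorBundle ∞ F W I']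
    (hnab : IsCompatibleConnectionAlong I I' F g J f nab) (hf : ContMDiff I I' ∞ f)
    (hg : ContMDiff I' (I'.prod 𝓘(ℝ, F →L[ℝ] F →L[ℝ] ℝ)) ∞
      (fun y ↦ TotalSpace.mk' (F →L[ℝ] F →L[ℝ] ℝ) (E := fun y ↦ W y →L[ℝ] W y →L[ℝ] ℝ) y (g y)))
    (nondegenerate : ∀ v, (∀ w, g (f x) v w = 0) → v = 0)
    (hJ : ContMDiff I' (I'.prod 𝓘(ℝ, F →L[ℝ] F)) ∞
      (fun y ↦ TotalSpace.mk' (F →L[ℝ] F) (E := fun y ↦ W y →L[ℝ] W y) y (J y)))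
    (hX : SmoothFieldAt X x) (hY : SmoothFieldAt Y x) :
    ∃ R : Module.End ℝ (W (f x)),
      (∀ s, (∀ᶠ y in 𝓝 x, SmoothSectionAlongAt I I' F f s y) →
        curvatureAlong nab X Y s x = R (s x)) ∧
      (g (f x)).toBilinForm.IsSkewAdjoint R ∧ Commute R (J (f x)).toLinearMap := by
  let ext (w : W (f x)) : Π y : M, W (f y) := fun y ↦ FiberBundle.extend F w (f y)
  have ext_apply (w) : ext w x = w := by simp [ext]
  have ext_smooth (w) : ∀ᶠ y in 𝓝 x, SmoothSectionAlongAt I I' F f (ext w) y :=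
    eventually_smoothSectionAlongAt_extend hf w
  have ext_unique {v v' : W (f x)} (h : ∀ w, g (f x) v w = g (f x) v' w) : v = v' :=
    sub_eq_zero.1 <| nondegenerate _ fun w ↦ by rw [map_sub, sub_apply, h, sub_self]
  have skew (w) {s : Π y : M, W (f y)} (hs : ∀ᶠ y in 𝓝 x, SmoothSectionAlongAt I I' F f s y) :
      g (f x) (curvatureAlong nab X Y s x) w
        = - g (f x) (s x) (curvatureAlong nab X Y (ext w) x) := by
    simpa only [ext_apply] using hnab.bilin_curvatureAlong hg hX hY hs (ext_smooth w)
  let R : Module.End ℝ (W (f x)) :=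
    { toFun := fun v ↦ curvatureAlong nab X Y (ext v) x
      map_add' := fun v v' ↦ ext_unique fun w ↦ by
        simp only [map_add, add_apply, skew w (ext_smooth _), ext_apply]; ring
      map_smul' := fun c v ↦ ext_unique fun w ↦ by
        simp [skew w (ext_smooth _), ext_apply] }
  have curvature_eq (s) (hs : ∀ᶠ y in 𝓝 x, SmoothSectionAlongAt I I' F f s y) :
      curvatureAlong nab X Y s x = R (s x) :=
    ext_unique fun w ↦ by rw [skew w hs]; simp [R, skew w (ext_smooth _), ext_apply]
  refine ⟨R, curvature_eq, fun v w ↦ ?_, LinearMap.ext fun v ↦ ?_⟩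
  · calc g (f x) (R v) w = - g (f x) (ext v x) (R w) := skew w (ext_smooth v)
      _ = - g (f x) v (R w) := by rw [ext_apply]
      _ = g (f x) v (- R w) := (map_neg _ _).symm
  · calc R (J (f x) v) = R (J (f x) (ext v x)) := by rw [ext_apply]
      _ = curvatureAlong nab X Y (fun y ↦ J (f y) (ext v y)) x :=
          (curvature_eq _ ((ext_smooth v).mono fun y hy ↦ hy.endo hJ)).symm
      _ = J (f x) (R v) := hnab.curvatureAlong_endo hJ hX hY (ext_smooth v)

end IsCompatibleConnectionAlong

end ConnectionsAlong

section Pullback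

variable {E : Type*} [NormedAddCommGroup E] [NormedSpace ℝ E]
  {H : Type*} [TopologicalSpace H] {I : ModelWithCorners ℝ E H}
  {M : Type*} [TopologicalSpace M] [ChartedSpace H M] [IsManifold I ∞ M]
  {E' : Type*} [NormedAddCommGroup E'] [NormedSpace ℝ E']
  {H' : Type*} [TopologicalSpace H'] {I' : ModelWithCorners ℝ E' H'}
  {N : Type*} [TopologicalSpace N] [ChartedSpace H' N]

section BundleConnections

variable {F : Type*} [NormedAddCommGroup F] [NormedSpace ℝ F]
  {W : N → Type*} [TopologicalSpace (TotalSpace F W)]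
  [∀ y, AddCommGroup (W y)] [∀ y, Module ℝ (W y)] [∀ y, TopologicalSpace (W y)]
  [∀ y, IsTopologicalAddGroup (W y)] [FiberBundle F W]
  {f : M → N} {nab : (Π x : M, W (f x)) → Π x : M, TangentSpace I x →L[ℝ] W (f x)}
  {g : Π y : N, W y →L[ℝ] W y →L[ℝ] ℝ} {J : Π y : N, W y →L[ℝ] W y}
  {s t : Π x : M, W (f x)} {x : M}

variable (I I' F) in
/-- The connection `nab` on the pullback of the vector bundle `W` by `f` is induced by the
connection `nabW` of `W`. The type of `nabW` is the one of connections along the identity. -/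
structure IsPullbackAlong (nabW : (Π y : N, W y) → Π y : N, TangentSpace I' y →L[ℝ] W y)
    (f : M → N) (nab : (Π x : M, W (f x)) → Π x : M, TangentSpace I x →L[ℝ] W (f x)) : Prop
    extends IsBundleConnectionAlong I I' F f nab where
  comp : ∀ (Z : Π y : N, W y) (x : M), SmoothSectionAt I' F Z (f x) → ∀ u : TangentSpace I x,
    nab (fun y ↦ Z (f y)) x u = nabW Z (f x) (mfderiv I I' f x u)

namespace IsBundleConnectionAlong

variable [VectorBundle ℝ F W]

theorem tensorialAlongAt_parallel [∀ y, ContinuousSMul ℝ (W y)]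
    (hnab : IsBundleConnectionAlong I I' F f nab)
    (hJ : ContMDiff I' (I'.prod 𝓘(ℝ, F →L[ℝ] F)) ∞
      (fun y ↦ TotalSpace.mk' (F →L[ℝ] F) (E := fun y ↦ W y →L[ℝ] W y) y (J y)))
    (u : TangentSpace I x) :
    TensorialAlongAt I I' F
      (fun s ↦ nab (fun y ↦ J (f y) (s y)) x u - J (f x) (nab s x u)) x where
  add hs ht := by
    simp only [map_add, hnab.add _ _ x (hs.endo hJ) (ht.endo hJ), hnab.add _ _ x hs ht, add_apply]
    abel
  smul hφ hs := by
    simp only [map_smul, hnab.leibniz _ _ x hφ (hs.endo hJ), hnab.leibniz _ _ x hφ hs, map_add,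
      add_sub_add_right_eq_sub, smul_sub]

variable (hg : ContMDiff I' (I'.prod 𝓘(ℝ, F →L[ℝ] F →L[ℝ] ℝ)) ∞
  (fun y ↦ TotalSpace.mk' (F →L[ℝ] F →L[ℝ] ℝ) (E := fun y ↦ W y →L[ℝ] W y →L[ℝ] ℝ) y (g y)))

include hg

theorem tensorialAlongAt_metric_left (hnab : IsBundleConnectionAlong I I' F f nab)
    (ht : SmoothSectionAlongAt I I' F f t x) (u : TangentSpace I x) :
    TensorialAlongAt I I' F (fun s ↦ mvfderiv I (fun y ↦ g (f y) (s y) (t y)) x u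
      - (g (f x) (nab s x u) (t x) + g (f x) (s x) (nab t x u))) x where
  add hs hs' := by
    simp only [map_add, add_apply, hnab.add _ _ x hs hs',
      mvfderiv_fun_add ((hs.bilin hg ht).mdifferentiableAt (by simp))
        ((hs'.bilin hg ht).mdifferentiableAt (by simp))]
    ring
  smul hφ hs := by
    simp only [map_smul, map_add, add_apply, smul_apply, smul_eq_mul, hnab.leibniz _ _ x hφ hs,
      mvfderiv_fun_mul (hφ.mdifferentiableAt (by simp))
        ((hs.bilin hg ht).mdifferentiableAt (by simp))]
    ring

theorem tensorialAlongAt_metric_right (hnab : IsBundleConnectionAlong I I' F f nab)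
    (hs : SmoothSectionAlongAt I I' F f s x) (u : TangentSpace I x) :
    TensorialAlongAt I I' F (fun t ↦ mvfderiv I (fun y ↦ g (f y) (s y) (t y)) x u
      - (g (f x) (nab s x u) (t x) + g (f x) (s x) (nab t x u))) x where
  add ht ht' := by
    simp only [map_add, add_apply, hnab.add _ _ x ht ht',
      mvfderiv_fun_add ((hs.bilin hg ht).mdifferentiableAt (by simp))
        ((hs.bilin hg ht').mdifferentiableAt (by simp))]
    ring
  smul hφ ht := by
    simp only [map_smul, map_add, add_apply, smul_apply, smul_eq_mul, hnab.leibniz _ _ x hφ ht,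
      mvfderiv_fun_mul (hφ.mdifferentiableAt (by simp))
        ((hs.bilin hg ht).mdifferentiableAt (by simp))]
    ring

end IsBundleConnectionAlong

variable [IsManifold I' ∞ N] [∀ y, ContinuousSMul ℝ (W y)] [VectorBundle ℝ F W]
  [ContMDiffVectorBundle ∞ F W I'] [FiniteDimensional ℝ F]
  {nabW : (Π y : N, W y) → Π y : N, TangentSpace I' y →L[ℝ] W y}

/- The defects of both identities are tensorial, so that it is enough to verify them on sections of
the form `Z ∘ f`, where they are those of `nabW`. -/
theorem IsPullbackAlong.isCompatibleConnectionAlong (hnab : IsPullbackAlong I I' F nabW f nab)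
    (hW : IsCompatibleConnectionAlong I' I' F g J (fun y ↦ y) nabW) (hf : ContMDiff I I' ∞ f)
    (hg : ContMDiff I' (I'.prod 𝓘(ℝ, F →L[ℝ] F →L[ℝ] ℝ)) ∞
      (fun y ↦ TotalSpace.mk' (F →L[ℝ] F →L[ℝ] ℝ) (E := fun y ↦ W y →L[ℝ] W y →L[ℝ] ℝ) y (g y)))
    (hJ : ContMDiff I' (I'.prod 𝓘(ℝ, F →L[ℝ] F)) ∞
      (fun y ↦ TotalSpace.mk' (F →L[ℝ] F) (E := fun y ↦ W y →L[ℝ] W y) y (J y))) :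
    IsCompatibleConnectionAlong I I' F g J f nab where
  toIsBundleConnectionAlong := hnab.toIsBundleConnectionAlong
  metric s t x hs ht u := by
    obtain ⟨Z, hZ, hZf, hsZ⟩ := hs.exists_comp_eq
    obtain ⟨Z', hZ', hZf', htZ⟩ := ht.exists_comp_eq
    have metric_comp : mvfderiv I (fun y ↦ g (f y) (Z (f y)) (Z' (f y))) x u
        = mvfderiv I' (fun y ↦ g y (Z y) (Z' y)) (f x) (mfderiv I I' f x u) :=
      mvfderiv_comp_apply (g := fun y ↦ g y (Z y) (Z' y)) x
        ((SmoothSectionAlongAt.bilin hg hZ hZ').mdifferentiableAt (by simp))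
        ((hf x).mdifferentiableAt (by simp)) u
    rw [← sub_eq_zero, (hnab.tensorialAlongAt_metric_left hg ht u).pointwise hs hZf hsZ,
      (hnab.tensorialAlongAt_metric_right hg hZf u).pointwise ht hZf' htZ, metric_comp,
      hW.metric Z Z' (f x) hZ hZ', hnab.comp Z x hZ, hnab.comp Z' x hZ', sub_self]
  parallel s x hs u := by
    obtain ⟨Z, hZ, hZf, hsZ⟩ := hs.exists_comp_eq
    have hJZ : SmoothSectionAt I' F (fun y ↦ J y (Z y)) (f x) := SmoothSectionAlongAt.endo hJ hZ
    rw [← sub_eq_zero, (hnab.tensorialAlongAt_parallel hJ u).pointwise hs hZf hsZ,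
      hnab.comp _ x hJZ, hW.parallel Z (f x) hZ, hnab.comp Z x hZ, sub_self]

end BundleConnections

section Torsion

variable [IsManifold I' ∞ N] {f : M → N} {X Y : Π x : M, TangentSpace I x} {x : M}
  {nab : (Π x : M, TangentSpace I' (f x)) → Π x : M, TangentSpace I x →L[ℝ] TangentSpace I' (f x)}
  {nabN : (Π y : N, TangentSpace I' y) → Π y : N, TangentSpace I' y →L[ℝ] TangentSpace I' y}
  {φ : N → ℝ}

/-- The Hessian of the function `φ` on the target of `f`, with respect to the connection `nab` of
the pullback of its tangent bundle, at the vector field `s` along `f` and the vector `u`. -/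
noncomputable def hessianAlong
    (nab : (Π x : M, TangentSpace I' (f x)) → Π x : M, TangentSpace I x →L[ℝ] TangentSpace I' (f x))
    (φ : N → ℝ) (s : Π x : M, TangentSpace I' (f x)) (x : M) (u : TangentSpace I x) : ℝ :=
  mvfderiv I (fun y ↦ mvfderiv I' φ (f y) (s y)) x u - mvfderiv I' φ (f x) (nab s x u)

theorem tensorialAlongAt_hessianAlong (hnab : IsBundleConnectionAlong I I' E' f nab)
    (hφ : ContMDiffAt I' 𝓘(ℝ, ℝ) ∞ φ (f x)) (u : TangentSpace I x) :
    TensorialAlongAt I I' E' (fun s ↦ hessianAlong nab φ s x u) x where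
  add hs ht := by
    simp only [hessianAlong, map_add, add_apply, hnab.add _ _ x hs ht,
      mvfderiv_fun_add ((hs.mvfderiv_apply hφ).mdifferentiableAt (by simp))
        ((ht.mvfderiv_apply hφ).mdifferentiableAt (by simp))]
    ring
  smul hψ hs := by
    simp only [hessianAlong, map_smul, map_add, add_apply, smul_apply, smul_eq_mul,
      hnab.leibniz _ _ x hψ hs, mvfderiv_fun_mul (hψ.mdifferentiableAt (by simp))
        ((hs.mvfderiv_apply hφ).mdifferentiableAt (by simp))]
    ring

theorem hessianAlong_id_symm [CompleteSpace E'] {Z Z' : Π y : N, TangentSpace I' y} {y : N}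
    (hφ : ∀ᶠ z in 𝓝 y, ContMDiffAt I' 𝓘(ℝ, ℝ) ∞ φ z)
    (hZ : SmoothFieldAt Z y) (hZ' : SmoothFieldAt Z' y)
    (torsion_free : nabN Z' y (Z y) - nabN Z y (Z' y) = VectorField.mlieBracket I' Z Z' y) :
    hessianAlong (f := fun y ↦ y) nabN φ Z' y (Z y)
      = hessianAlong (f := fun y ↦ y) nabN φ Z y (Z' y) := by
  have bracket := mvfderiv_mlieBracket hφ hZ hZ'
  rw [← torsion_free, map_sub] at bracket
  simp only [hessianAlong]
  linarith

theorem eq_of_forall_mvfderiv_eq {y : N} {v w : TangentSpace I' y}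
    (h : ∀ φ : N → ℝ, (∀ᶠ z in 𝓝 y, ContMDiffAt I' 𝓘(ℝ, ℝ) ∞ φ z) →
      mvfderiv I' φ y v = mvfderiv I' φ y w) : v = w := by
  have : IsManifold I' 1 N := IsManifold.of_le (n := ∞) (by simp)
  have chart_differential : mfderiv I' 𝓘(ℝ, E') (extChartAt I' y) y v
      = mfderiv I' 𝓘(ℝ, E') (extChartAt I' y) y w := by
    refine (SeparatingDual.eq_iff_forall_dual_eq (R := ℝ) (V := E')).2 fun ℓ ↦ ?_
    have smooth : ∀ᶠ z in 𝓝 y, ContMDiffAt I' 𝓘(ℝ, ℝ) ∞ (ℓ ∘ extChartAt I' y) z := by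
      filter_upwards [(chartAt H' y).open_source.mem_nhds (mem_chart_source H' y)] with z hz
      exact ℓ.contMDiff.contMDiffAt.comp z (contMDiffAt_extChartAt' hz)
    have chain (u : TangentSpace I' y) : mvfderiv I' (ℓ ∘ extChartAt I' y) y u
        = ℓ (mfderiv I' 𝓘(ℝ, E') (extChartAt I' y) y u) := by
      rw [mvfderiv_comp_apply y (ℓ.contMDiff.contMDiffAt.mdifferentiableAt one_ne_zero)
        (contMDiffAt_extChartAt.mdifferentiableAt one_ne_zero) u]
      exact DFunLike.congr_fun ℓ.mfderiv_eq _
    simpa only [chain] using h _ smooth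
  exact (isInvertible_mfderiv_extChartAt (mem_extChartAt_source y)).injective chart_differential

variable [FiniteDimensional ℝ E']

theorem IsPullbackAlong.hessianAlong_eq (hnab : IsPullbackAlong I I' E' nabN f nab)
    (hφ : ContMDiffAt I' 𝓘(ℝ, ℝ) ∞ φ (f x)) {s : Π x : M, TangentSpace I' (f x)}
    (hs : SmoothSectionAlongAt I I' E' f s x) {Z : Π y : N, TangentSpace I' y}
    (hZ : SmoothFieldAt Z (f x)) (hsZ : s x = Z (f x)) (u : TangentSpace I x) :
    hessianAlong nab φ s x u
      = hessianAlong (f := fun y ↦ y) nabN φ Z (f x) (mfderiv I I' f x u) := by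
  have hf := hs.contMDiffAt_base
  have hφZ := SmoothSectionAlongAt.mvfderiv_apply (f := fun y ↦ y) hφ hZ
  have hessian_comp := (tensorialAlongAt_hessianAlong hnab.toIsBundleConnectionAlong hφ u).pointwise
    hs (SmoothSectionAt.comp hZ hf) hsZ
  have chain : mvfderiv I (fun y ↦ mvfderiv I' φ (f y) (Z (f y))) x u
      = mvfderiv I' (fun y ↦ mvfderiv I' φ y (Z y)) (f x) (mfderiv I I' f x u) :=
    mvfderiv_comp_apply (g := fun y ↦ mvfderiv I' φ y (Z y)) x (hφZ.mdifferentiableAt (by simp))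
      (hf.mdifferentiableAt (by simp)) u
  rw [hessian_comp, hessianAlong, chain, hnab.comp Z x hZ, hessianAlong]

theorem IsPullbackAlong.hessianAlong_mfderiv_symm (hnab : IsPullbackAlong I I' E' nabN f nab)
    (hf : ContMDiff I I' ∞ f)
    (torsion_free : ∀ (Z Z' : Π y : N, TangentSpace I' y) (y : N), SmoothFieldAt Z y →
      SmoothFieldAt Z' y → nabN Z' y (Z y) - nabN Z y (Z' y) = VectorField.mlieBracket I' Z Z' y)
    (hφ : ∀ᶠ z in 𝓝 (f x), ContMDiffAt I' 𝓘(ℝ, ℝ) ∞ φ z)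
    (hX : SmoothFieldAt X x) (hY : SmoothFieldAt Y x) :
    hessianAlong nab φ (fun y ↦ mfderiv I I' f y (Y y)) x (X x)
      = hessianAlong nab φ (fun y ↦ mfderiv I I' f y (X y)) x (Y x) := by
  have hφx := hφ.self_of_nhds
  have hfX := smoothSectionAlongAt_mfderiv (hf x) hX
  have hfY := smoothSectionAlongAt_mfderiv (hf x) hY
  obtain ⟨Z, hZ, -, hXZ⟩ := hfX.exists_comp_eq
  obtain ⟨Z', hZ', -, hYZ'⟩ := hfY.exists_comp_eq
  rw [hnab.hessianAlong_eq hφx hfY hZ' hYZ', hnab.hessianAlong_eq hφx hfX hZ hXZ, hXZ, hYZ',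
    hessianAlong_id_symm hφ hZ hZ' (torsion_free Z Z' _ hZ hZ')]

theorem IsPullbackAlong.torsion_free [CompleteSpace E] (hnab : IsPullbackAlong I I' E' nabN f nab)
    (hf : ContMDiff I I' ∞ f)
    (torsion_free : ∀ (Z Z' : Π y : N, TangentSpace I' y) (y : N), SmoothFieldAt Z y →
      SmoothFieldAt Z' y → nabN Z' y (Z y) - nabN Z y (Z' y) = VectorField.mlieBracket I' Z Z' y)
    (hX : SmoothFieldAt X x) (hY : SmoothFieldAt Y x) :
    nab (fun y ↦ mfderiv I I' f y (Y y)) x (X x) - nab (fun y ↦ mfderiv I I' f y (X y)) x (Y x)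
      = mfderiv I I' f x (VectorField.mlieBracket I X Y x) := by
  refine eq_of_forall_mvfderiv_eq fun φ hφ ↦ ?_
  have hφf : ∀ᶠ y in 𝓝 x, ContMDiffAt I' 𝓘(ℝ, ℝ) ∞ φ (f y) := (hf x).continuousAt.eventually hφ
  have chain (Z : Π y : M, TangentSpace I y) :
      ∀ᶠ y in 𝓝 x, mvfderiv I (φ ∘ f) y (Z y) = mvfderiv I' φ (f y) (mfderiv I I' f y (Z y)) :=
    hφf.mono fun y hy ↦ mvfderiv_comp_apply y (hy.mdifferentiableAt (by simp))
      ((hf y).mdifferentiableAt (by simp)) (Z y)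
  have hessian_symm := hnab.hessianAlong_mfderiv_symm hf torsion_free hφ hX hY
  have bracket := mvfderiv_mlieBracket (hφf.mono fun y hy ↦ hy.comp y (hf y)) hX hY
  rw [(chain (VectorField.mlieBracket I X Y)).self_of_nhds,
    mvfderiv_congr_of_eventuallyEq (chain X), mvfderiv_congr_of_eventuallyEq (chain Y)] at bracket
  simp only [hessianAlong] at hessian_symm
  rw [bracket, map_sub]
  linarith

end Torsion

end Pullback

section PlaneAlgebra

variable {K : Type*} [Field K] {U W : Type*} [AddCommGroup U] [Module K U]
  [AddCommGroup W] [Module K W]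

theorem eq_zero_of_isAlt_of_finrank_eq_two {B : LinearMap.BilinForm K U} (hB : B.IsAlt)
    (hU : Module.finrank K U = 2) {u : U} (hu : u ≠ 0) (hBu : B u = 0) : B = 0 := by
  have : FiniteDimensional K U := .of_finrank_pos (by omega)
  by_contra hB0
  obtain ⟨y, z, hyz⟩ : ∃ y z, B y z ≠ 0 := by
    by_contra! h
    exact hB0 (LinearMap.ext₂ h)
  have hBu' (w : U) : B w u = 0 := hB.isRefl u w (by rw [hBu, LinearMap.zero_apply])
  have independent : LinearIndependent K ![u, y, z] := by
    refine Fintype.linearIndependent_iff.2 fun c hc ↦ ?_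
    simp only [Fin.sum_univ_three, Matrix.cons_val] at hc
    have c_one : c 1 = 0 := by
      simpa [hB.self_eq_zero, hBu, hyz] using congrArg (fun w ↦ B w z) hc
    have c_two : c 2 = 0 := by
      simpa [hB.self_eq_zero, hBu', hyz] using congrArg (B y) hc
    have c_zero : c 0 = 0 := by simpa [c_one, c_two, hu] using hc
    exact fun i ↦ by fin_cases i <;> assumption
  have := independent.fintype_card_le_finrank
  simp [hU] at this

variable {G : LinearMap.BilinForm K W} {J L : Module.End K W} {T : Submodule K W}

theorem orthogonal_mem_invtSubmodule (hJ : G.IsSkewAdjoint J) (hT : T ∈ J.invtSubmodule) :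
    G.orthogonal T ∈ J.invtSubmodule := by
  intro ξ hξ t ht
  have skew : G (J t) ξ = -G t (J ξ) := (hJ t ξ).trans (map_neg _ _)
  exact neg_eq_zero.1 (skew.symm.trans (hξ _ (hT ht)))

theorem isAlt_compLeft_of_isSkewAdjoint [NeZero (2 : K)] (hsymm : G.IsSymm)
    (hL : G.IsSkewAdjoint L) : (G.compLeft L).IsAlt := by
  intro v
  have skew : G (L v) v = -G (L v) v :=
    (hL v v).trans (by rw [Pi.neg_apply, map_neg, hsymm.eq])
  rw [eq_neg_iff_add_eq_zero, ← two_mul] at skew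
  exact (mul_eq_zero_iff_left two_ne_zero).1 skew

theorem apply_eq_zero_of_mem_orthogonal (hG : G.Nondegenerate) (hsymm : G.IsSymm)
    (hT : Codisjoint T (G.orthogonal T)) (hL : G.IsSkewAdjoint L) (hTL : T ∈ L.invtSubmodule)
    (normal : ∀ ξ ∈ G.orthogonal T, ∀ η ∈ G.orthogonal T, G (L ξ) η = 0) {ξ : W}
    (hξ : ξ ∈ G.orthogonal T) : L ξ = 0 := by
  have hLξ : L ξ ∈ G.orthogonal T := orthogonal_mem_invtSubmodule hL hTL hξ
  refine hG.1 _ fun w ↦ ?_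
  obtain ⟨t, η, ht, hη, rfl⟩ := Submodule.codisjoint_iff_exists_add_eq.1 hT w
  rw [map_add, normal ξ hξ η hη, add_zero, hsymm.eq]
  exact hLξ t ht

variable [FiniteDimensional K W]

theorem exists_mem_ne_zero_apply_eq_zero (hG : G.Nondegenerate) (hrefl : G.IsRefl)
    (hT : Codisjoint T (G.orthogonal T)) (hJ : G.IsSkewAdjoint J) (hTJ : T ∉ J.invtSubmodule)
    (hLJ : Commute L J) (hLT : ∀ ξ ∈ G.orthogonal T, L ξ = 0) : ∃ u ∈ T, u ≠ 0 ∧ L u = 0 := by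
  obtain ⟨ξ, hξ, hJξ⟩ : ∃ ξ ∈ G.orthogonal T, J ξ ∉ G.orthogonal T := by
    by_contra! h
    rw [← LinearMap.BilinForm.orthogonal_orthogonal hG hrefl T] at hTJ
    exact hTJ (orthogonal_mem_invtSubmodule hJ h)
  obtain ⟨u, η, hu, hη, huη⟩ := Submodule.codisjoint_iff_exists_add_eq.1 hT (J ξ)
  refine ⟨u, hu, ?_, ?_⟩
  · rintro rfl
    exact hJξ (by rwa [← huη, zero_add])
  · calc L u = L (J ξ) := by rw [← huη, map_add, hLT η hη, add_zero]
      _ = J (L ξ) := DFunLike.congr_fun hLJ.eq ξ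
      _ = 0 := by rw [hLT ξ hξ, map_zero]

theorem eq_zero_of_isSkewAdjoint_of_commute [NeZero (2 : K)] (hG : G.Nondegenerate)
    (hsymm : G.IsSymm) (hT : Module.finrank K T = 2) (hT' : Codisjoint T (G.orthogonal T))
    (hJ : G.IsSkewAdjoint J) (hTJ : T ∉ J.invtSubmodule) (hL : G.IsSkewAdjoint L)
    (hLJ : Commute L J) (hTL : T ∈ L.invtSubmodule)
    (normal : ∀ ξ ∈ G.orthogonal T, ∀ η ∈ G.orthogonal T, G (L ξ) η = 0) : L = 0 := by
  have kernel : ∀ ξ ∈ G.orthogonal T, L ξ = 0 :=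
    fun ξ ↦ apply_eq_zero_of_mem_orthogonal hG hsymm hT' hL hTL normal
  obtain ⟨u, hu, hu0, hLu⟩ :=
    exists_mem_ne_zero_apply_eq_zero hG hsymm.isRefl hT' hJ hTJ hLJ kernel
  have form_eq_zero : (G.compLeft L).restrict T = 0 :=
    eq_zero_of_isAlt_of_finrank_eq_two (u := ⟨u, hu⟩)
      (fun v ↦ isAlt_compLeft_of_isSkewAdjoint hsymm hL v) hT (by simpa using hu0)
      (LinearMap.ext fun v ↦ by simp [hLu])
  have tangent (t : W) (ht : t ∈ T) : L t = 0 := by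
    refine hG.1 _ fun w ↦ ?_
    obtain ⟨t', η, ht', hη, rfl⟩ := Submodule.codisjoint_iff_exists_add_eq.1 hT' w
    have tangential : G (L t) t' = 0 := LinearMap.congr_fun₂ form_eq_zero ⟨t, ht⟩ ⟨t', ht'⟩
    rw [map_add, tangential, hη (L t) (hTL ht), add_zero]
  ext w
  obtain ⟨t, ζ, ht, hζ, rfl⟩ := Submodule.codisjoint_iff_exists_add_eq.1 hT' w
  rw [map_add, tangent t ht, kernel ζ hζ, add_zero, LinearMap.zero_apply]

end PlaneAlgebra

section OrthogonalSum

variable {K : Type*} [Field K] {U V W : Type*} [AddCommGroup U] [Module K U]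
  [AddCommGroup V] [Module K V] [AddCommGroup W] [Module K W]
  {G : LinearMap.BilinForm K W} {τ : U →ₗ[K] W} {ν : V →ₗ[K] W}

theorem injective_of_nondegenerate_comp (hτ : (G.comp τ τ).Nondegenerate) :
    Function.Injective τ := by
  refine (injective_iff_map_eq_zero τ).2 fun u hu ↦ hτ.1 u fun v ↦ ?_
  rw [LinearMap.BilinForm.comp_apply, hu, map_zero, LinearMap.zero_apply]

theorem disjoint_range_orthogonal (hG : G.IsRefl) (hτ : (G.comp τ τ).Nondegenerate) :
    Disjoint (LinearMap.range τ) (G.orthogonal (LinearMap.range τ)) := by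
  rw [Submodule.disjoint_def]
  rintro _ ⟨u, rfl⟩ hu
  rw [hτ.1 u fun v ↦ hG _ _ (hu (τ v) ⟨v, rfl⟩), map_zero]

variable [FiniteDimensional K W]

theorem isCompl_range_orthogonal (hG : G.IsRefl) (hτ : (G.comp τ τ).Nondegenerate) :
    IsCompl (LinearMap.range τ) (G.orthogonal (LinearMap.range τ)) :=
  (LinearMap.BilinForm.isCompl_orthogonal_iff_disjoint hG).2 (disjoint_range_orthogonal hG hτ)

theorem range_eq_orthogonal_range (hG : G.Nondegenerate) (hτ : Function.Injective τ)
    (hν : Function.Injective ν) (horth : ∀ u ξ, G (τ u) (ν ξ) = 0)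
    (hdim : Module.finrank K U + Module.finrank K V = Module.finrank K W) :
    LinearMap.range ν = G.orthogonal (LinearMap.range τ) := by
  refine Submodule.eq_of_le_of_finrank_eq ?_ ?_
  · rintro _ ⟨ξ, rfl⟩ _ ⟨u, rfl⟩
    exact horth u ξ
  · rw [LinearMap.BilinForm.finrank_orthogonal hG, LinearMap.finrank_range_of_inj hτ,
      LinearMap.finrank_range_of_inj hν]
    omega

end OrthogonalSum

section IndexOne

variable {E : Type*} [NormedAddCommGroup E] [NormedSpace ℝ E]
  {H : Type*} [TopologicalSpace H] {I : ModelWithCorners ℝ E H}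
  {M : Type*} [TopologicalSpace M] [ChartedSpace H M] [IsManifold I ∞ M]
  {g : Π x : M, TangentSpace I x →L[ℝ] TangentSpace I x →L[ℝ] ℝ}

theorem IsLorentzMetric.exists_neg (hg : IsLorentzMetric g) (x : M) : ∃ u, g x u u < 0 := by
  obtain ⟨W, hW, hd⟩ := (hg.index_one x).1
  have : Nontrivial W := Module.nontrivial_of_finrank_pos (R := ℝ) (by omega)
  obtain ⟨⟨u, hu⟩, hne⟩ := exists_ne (0 : W)
  exact ⟨u, hW u hu fun h ↦ hne (Subtype.ext h)⟩

theorem IsLorentzMetric.ne_zero_of_neg (hg : IsLorentzMetric g) {x : M} {u v : TangentSpace I x}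
    (hu : g x u u < 0) (hv : g x v v < 0) : g x u v ≠ 0 := by
  intro huv
  have combination_neg (a b : ℝ) (hab : a ≠ 0 ∨ b ≠ 0) :
      g x (a • u + b • v) (a • u + b • v) < 0 := by
    have expand : g x (a • u + b • v) (a • u + b • v) = a ^ 2 * g x u u + b ^ 2 * g x v v := by
      simp only [map_add, map_smul, add_apply, smul_apply, smul_eq_mul, huv, hg.symm x v u]
      ring
    rw [expand]
    rcases hab with ha | hb
    · exact add_neg_of_neg_of_nonpos (mul_neg_of_pos_of_neg (by positivity) hu)
        (mul_nonpos_of_nonneg_of_nonpos (sq_nonneg b) hv.le)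
    · exact add_neg_of_nonpos_of_neg (mul_nonpos_of_nonneg_of_nonpos (sq_nonneg a) hu.le)
        (mul_neg_of_pos_of_neg (by positivity) hv)
  have independent : LinearIndependent ℝ ![u, v] := by
    refine LinearIndependent.pair_iff.2 fun a b hab ↦ ?_
    by_contra h
    have := combination_neg a b (not_and_or.1 h)
    rw [hab, map_zero] at this
    exact this.false
  have negative : IsNegativeDefiniteOn g x (Submodule.span ℝ {u, v}) := by
    intro w hw hw0
    obtain ⟨a, b, rfl⟩ := Submodule.mem_span_pair.1 hw
    refine combination_neg a b ?_
    by_contra! hab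
    simp [hab] at hw0
  have plane := finrank_span_eq_card independent
  rw [Matrix.range_cons_cons_empty, Fintype.card_fin] at plane
  exact absurd ((hg.index_one x).2 ⟨_, negative, plane⟩) (by norm_num)

theorem IsLorentzMetric.exists_apply_notMem_range (hg : IsLorentzMetric g) (x : M) {W : Type*}
    [AddCommGroup W] [Module ℝ W] {G : LinearMap.BilinForm ℝ W} {J : Module.End ℝ W}
    (hJ : (G.compLeft J).IsAlt) (hGJ : ∀ a b, G (J a) (J b) = G a b)
    {τ : TangentSpace I x →ₗ[ℝ] W} (hτ : ∀ u v, G (τ u) (τ v) = g x u v) :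
    ∃ u, J (τ u) ∉ LinearMap.range τ := by
  obtain ⟨u, hu⟩ := hg.exists_neg x
  refine ⟨u, ?_⟩
  rintro ⟨v, hv⟩
  have orthogonal : g x v u = 0 := by rw [← hτ, hv]; exact hJ (τ u)
  have negative : g x v v < 0 := by rwa [← hτ, hv, hGJ, hτ]
  exact hg.ne_zero_of_neg negative hu orthogonal

end IndexOne

section KaehlerConnections

theorem IsSmoothConnection.isBundleConnectionAlong {E : Type*} [NormedAddCommGroup E]
    [NormedSpace ℝ E] {H : Type*} [TopologicalSpace H] {I : ModelWithCorners ℝ E H}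
    {M : Type*} [TopologicalSpace M] [ChartedSpace H M] [IsManifold I ∞ M]
    {F : Type*} [NormedAddCommGroup F] [NormedSpace ℝ F]
    {W : M → Type*} [TopologicalSpace (TotalSpace F W)]
    [∀ y, AddCommGroup (W y)] [∀ y, Module ℝ (W y)] [∀ y, TopologicalSpace (W y)]
    [∀ y, IsTopologicalAddGroup (W y)] [∀ y, ContinuousSMul ℝ (W y)] [FiberBundle F W]
    {nabla : CovariantDerivative I F W} (h : IsSmoothConnection nabla) :
    IsBundleConnectionAlong I I F (fun x : M ↦ x) nabla where
  add _ _ _ hs ht := nabla.isCovariantDerivativeOnUniv.add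
    (ContMDiffAt.mdifferentiableAt hs (by simp)) (ContMDiffAt.mdifferentiableAt ht (by simp))
  leibniz _ _ _ hφ hs := DFunLike.congr_fun <| nabla.isCovariantDerivativeOnUniv.leibniz
    (ContMDiffAt.mdifferentiableAt hs (by simp)) (hφ.mdifferentiableAt (by simp))
  smooth s X x hs hX := h s X x hs hX

section Kaehler

variable {E : Type*} [NormedAddCommGroup E] [NormedSpace ℝ E]
  {H : Type*} [TopologicalSpace H] {I : ModelWithCorners ℝ E H}
  {N : Type*} [TopologicalSpace N] [ChartedSpace H N] [IsManifold I ∞ N]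
  {g : Π y : N, TangentSpace I y →L[ℝ] TangentSpace I y →L[ℝ] ℝ}
  {J : Π y : N, TangentSpace I y →L[ℝ] TangentSpace I y}
  {nabla : CovariantDerivative I E (TangentSpace I : N → Type _)}

theorem IsLorentzianKaehler.isCompatibleConnectionAlong (hN : IsLorentzianKaehler g J nabla) :
    IsCompatibleConnectionAlong I I E g J (fun y ↦ y) nabla where
  toIsBundleConnectionAlong := hN.levi_civita.smooth.isBundleConnectionAlong
  metric := hN.levi_civita.metric
  parallel := hN.parallel

theorem IsLorentzianKaehler.isSkewAdjoint (hN : IsLorentzianKaehler g J nabla) (y : N) :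
    (g y).toBilinForm.IsSkewAdjoint (J y).toLinearMap := fun u v ↦
  calc g y (J y u) v = - g y (J y u) (J y (J y v)) := by
        rw [hN.almost_complex, map_neg, neg_neg]
    _ = - g y u (J y v) := by rw [hN.hermitian]
    _ = g y u (- J y v) := (map_neg _ _).symm

end Kaehler

variable {M : Type*} [TopologicalSpace M] [ChartedSpace (R 2) M] [IsManifold (𝓡 2) ∞ M]
  {N : Type*} [TopologicalSpace N] [ChartedSpace (R 4) N] [IsManifold (𝓡 4) ∞ N]
  {gN : Π y : N, TangentSpace (𝓡 4) y →L[ℝ] TangentSpace (𝓡 4) y →L[ℝ] ℝ}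
  {J : Π y : N, TangentSpace (𝓡 4) y →L[ℝ] TangentSpace (𝓡 4) y}
  {nablaN : CovariantDerivative (𝓡 4) (R 4) (TangentSpace (𝓡 4) : N → Type _)}
  {f : M → N} {τ : Π x : M, TangentSpace (𝓡 2) x →L[ℝ] TangentSpace (𝓡 4) (f x)}
  {nab : (Π x : M, TangentSpace (𝓡 4) (f x)) →
    Π x : M, TangentSpace (𝓡 2) x →L[ℝ] TangentSpace (𝓡 4) (f x)}

theorem IsConnectionAlong.isBundleConnectionAlong (hnab : IsConnectionAlong f nab) :
    IsBundleConnectionAlong (𝓡 2) (𝓡 4) (R 4) f nab where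
  add := hnab.add
  leibniz := hnab.leibniz
  smooth := hnab.smooth

theorem IsKaehlerConnectionAlong.isCompatibleConnectionAlong
    (hnab : IsKaehlerConnectionAlong gN J f τ nab) :
    IsCompatibleConnectionAlong (𝓡 2) (𝓡 4) (R 4) gN J f nab where
  toIsBundleConnectionAlong := hnab.toIsConnectionAlong.isBundleConnectionAlong
  metric := hnab.metric
  parallel := hnab.parallel

theorem IsPullbackConnection.isKaehlerConnectionAlong (hnab : IsPullbackConnection nablaN f nab)
    (hf : ContMDiff (𝓡 2) (𝓡 4) ∞ f) (hN : IsLorentzianKaehler gN J nablaN) :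
    IsKaehlerConnectionAlong gN J f (fun x ↦ mfderiv (𝓡 2) (𝓡 4) f x) nab := by
  have pullback : IsPullbackAlong (𝓡 2) (𝓡 4) (R 4) nablaN f nab :=
    { toIsBundleConnectionAlong := hnab.isBundleConnectionAlong
      comp := hnab.comp }
  have compatible := pullback.isCompatibleConnectionAlong hN.isCompatibleConnectionAlong hf
    hN.metric.smooth hN.smooth
  exact
    { toIsConnectionAlong := hnab.toIsConnectionAlong
      metric := compatible.metric
      parallel := compatible.parallel
      torsion_free := fun X Y x ↦ pullback.torsion_free hf hN.levi_civita.torsion_free }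

end KaehlerConnections

section StructureEquations

variable {M : Type*} [TopologicalSpace M] [ChartedSpace (R 2) M] [IsManifold (𝓡 2) ∞ M]
  {N : Type*} [TopologicalSpace N] [ChartedSpace (R 4) N] [IsManifold (𝓡 4) ∞ N]
  {V : M → Type*} [TopologicalSpace (TotalSpace (R 2) V)]
  [∀ x, AddCommGroup (V x)] [∀ x, Module ℝ (V x)] [∀ x, TopologicalSpace (V x)]
  [∀ x, IsTopologicalAddGroup (V x)] [∀ x, ContinuousSMul ℝ (V x)]
  [FiberBundle (R 2) V]
  {g : Π x : M, TangentSpace (𝓡 2) x →L[ℝ] TangentSpace (𝓡 2) x →L[ℝ] ℝ}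
  {nabla : CovariantDerivative (𝓡 2) (R 2) (TangentSpace (𝓡 2) : M → Type _)}
  {gN : Π y : N, TangentSpace (𝓡 4) y →L[ℝ] TangentSpace (𝓡 4) y →L[ℝ] ℝ}
  {J : Π y : N, TangentSpace (𝓡 4) y →L[ℝ] TangentSpace (𝓡 4) y}
  {nablaN : CovariantDerivative (𝓡 4) (R 4) (TangentSpace (𝓡 4) : N → Type _)}
  {f : M → N} {τ : Π x : M, TangentSpace (𝓡 2) x →L[ℝ] TangentSpace (𝓡 4) (f x)}
  {ν : Π x : M, V x →L[ℝ] TangentSpace (𝓡 4) (f x)}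
  {nab : (Π x : M, TangentSpace (𝓡 4) (f x)) →
    Π x : M, TangentSpace (𝓡 2) x →L[ℝ] TangentSpace (𝓡 4) (f x)}
  {h : Π x : M, TangentSpace (𝓡 2) x →L[ℝ] TangentSpace (𝓡 2) x →L[ℝ] V x}
  {A : Π x : M, V x →L[ℝ] TangentSpace (𝓡 2) x →L[ℝ] TangentSpace (𝓡 2) x}
  {D : CovariantDerivative (𝓡 2) (R 2) V} {x : M}

namespace GaussWeingarten

theorem secondForm_symm (hGW : GaussWeingarten nabla f τ ν nab h A D)
    (hnabla : IsLeviCivita g nabla) (hs : IsSplitting g gN f τ ν)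
    (hnab : IsKaehlerConnectionAlong gN J f τ nab) (u v : TangentSpace (𝓡 2) x) :
    h x u v = h x v u := by
  have hu := (eventually_smoothSectionAt_extend (I := 𝓡 2) (F := R 2) u).self_of_nhds
  have hv := (eventually_smoothSectionAt_extend (I := 𝓡 2) (F := R 2) v).self_of_nhds
  have torsion_free := hnab.torsion_free _ _ x hu hv
  rw [hGW.gauss _ x hu, hGW.gauss _ x hv, ← hnabla.torsion_free _ _ x hu hv] at torsion_free
  simp only [FiberBundle.extend_apply_self, map_sub] at torsion_free
  rw [add_sub_add_comm, add_eq_left, sub_eq_zero] at torsion_free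
  exact hs.injective x torsion_free

theorem nab_nab_tangent (hGW : GaussWeingarten nabla f τ ν nab h A D)
    (hnabla : IsLeviCivita g nabla) (hs : IsSplitting g gN f τ ν)
    (hnab : IsConnectionAlong f nab) {B Z : Π y : M, TangentSpace (𝓡 2) y}
    (hZ : ∀ᶠ y in 𝓝 x, SmoothFieldAt Z y) (hB : SmoothFieldAt B x) (u : TangentSpace (𝓡 2) x) :
    nab (fun y ↦ nab (fun y ↦ τ y (Z y)) y (B y)) x u
      = τ x (nabla (fun y ↦ nabla Z y (B y)) x u - A x (h x (B x) (Z x)) u)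
        + ν x (h x u (nabla Z x (B x)) + D (fun y ↦ h y (B y) (Z y)) x u) := by
  have hnab' := hnab.isBundleConnectionAlong
  have hBZ := hnabla.smooth Z B x hZ.self_of_nhds hB
  have hhBZ := hGW.smooth_h B Z x hB hZ.self_of_nhds
  have tangent : SmoothSectionAlongAt (𝓡 2) (𝓡 4) (R 4) f _ x := hs.smooth_tangent _ x hBZ
  have normal : SmoothSectionAlongAt (𝓡 2) (𝓡 4) (R 4) f _ x := hs.smooth_normal _ x hhBZ
  rw [hnab'.congr (tangent.add normal) (hZ.mono fun y hy ↦ hGW.gauss _ y hy (B y)),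
    hnab'.add _ _ x tangent normal, add_apply, hGW.gauss _ x hBZ, hGW.weingarten _ x hhBZ,
    map_sub, map_add]
  abel

theorem curvatureAlong_tangent (hGW : GaussWeingarten nabla f τ ν nab h A D)
    (hnabla : IsLeviCivita g nabla) (hs : IsSplitting g gN f τ ν)
    (hnab : IsConnectionAlong f nab) (u v z : TangentSpace (𝓡 2) x) :
    curvatureAlong nab (FiberBundle.extend (R 2) u) (FiberBundle.extend (R 2) v)
        (fun y ↦ τ y (FiberBundle.extend (R 2) z y)) x
      = τ x (curvature nabla x u v z - A x (h x v z) u + A x (h x u z) v)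
        + ν x (covDerivSecondForm nabla h D x u v z - covDerivSecondForm nabla h D x v u z) := by
  have hu := (eventually_smoothSectionAt_extend (I := 𝓡 2) (F := R 2) u).self_of_nhds
  have hv := (eventually_smoothSectionAt_extend (I := 𝓡 2) (F := R 2) v).self_of_nhds
  have hz := eventually_smoothSectionAt_extend (I := 𝓡 2) (F := R 2) z
  rw [curvatureAlong, hGW.nab_nab_tangent hnabla hs hnab hz hv,
    hGW.nab_nab_tangent hnabla hs hnab hz hu, hGW.gauss _ x hz.self_of_nhds]
  simp only [curvature, curvatureField, covDerivSecondForm, FiberBundle.extend_apply_self,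
    map_sub, map_add, sub_apply, ← hnabla.torsion_free _ _ x hu hv]
  abel

theorem codazziEquationAt_iff (hGW : GaussWeingarten nabla f τ ν nab h A D)
    (hnabla : IsLeviCivita g nabla) (hs : IsSplitting g gN f τ ν)
    (hnab : IsConnectionAlong f nab) :
    CodazziEquationAt nabla nablaN f τ ν h D x ↔ ∀ u v z : TangentSpace (𝓡 2) x,
      curvatureAlong nab (FiberBundle.extend (R 2) u) (FiberBundle.extend (R 2) v)
          (fun y ↦ τ y (FiberBundle.extend (R 2) z y)) x
          - curvature nablaN (f x) (τ x u) (τ x v) (τ x z)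
        ∈ LinearMap.range (τ x).toLinearMap := by
  refine forall₃_congr fun u v z ↦ ?_
  rw [hGW.curvatureAlong_tangent hnabla hs hnab]
  set t := curvature nabla x u v z - A x (h x v z) u + A x (h x u z) v
  constructor
  · rintro ⟨t', ht'⟩
    exact ⟨t - t', by rw [ht', ContinuousLinearMap.coe_coe, map_sub]; abel⟩
  · rintro ⟨t', ht'⟩
    rw [ContinuousLinearMap.coe_coe] at ht'
    exact ⟨t - t', by rw [map_sub (τ x), ht']; abel⟩

theorem nab_nab_normal_sub_mem_range (hGW : GaussWeingarten nabla f τ ν nab h A D)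
    (hs : IsSplitting g gN f τ ν) (hnab : IsConnectionAlong f nab)
    {B : Π y : M, TangentSpace (𝓡 2) y} {ξ : Π y : M, V y}
    (hξ : ∀ᶠ y in 𝓝 x, SmoothSectionAt (𝓡 2) (R 2) ξ y) (hB : SmoothFieldAt B x)
    (u : TangentSpace (𝓡 2) x) :
    nab (fun y ↦ nab (fun y ↦ ν y (ξ y)) y (B y)) x u
        - ν x (D (fun y ↦ D ξ y (B y)) x u - h x u (A x (ξ x) (B x)))
      ∈ LinearMap.range (τ x).toLinearMap := by
  have hnab' := hnab.isBundleConnectionAlong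
  have hAξB := hGW.smooth_A ξ B x hξ.self_of_nhds hB
  have hDξB := hGW.smooth_D ξ B x hξ.self_of_nhds hB
  have tangent : SmoothSectionAlongAt (𝓡 2) (𝓡 4) (R 4) f _ x := hs.smooth_tangent _ x hAξB
  have normal : SmoothSectionAlongAt (𝓡 2) (𝓡 4) (R 4) f _ x := hs.smooth_normal _ x hDξB
  refine ⟨- nabla (fun y ↦ A y (ξ y) (B y)) x u - A x (D ξ x (B x)) u, ?_⟩
  rw [hnab'.congr (tangent.neg.add normal) (hξ.mono fun y hy ↦ hGW.weingarten _ y hy (B y)),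
    hnab'.add _ _ x tangent.neg normal, add_apply, hnab'.neg tangent, neg_apply,
    hGW.gauss _ x hAξB, hGW.weingarten _ x hDξB, ContinuousLinearMap.coe_coe, map_sub, map_sub,
    map_neg]
  abel

variable [VectorBundle ℝ (R 2) V] [ContMDiffVectorBundle ∞ (R 2) V (𝓡 2)]

theorem curvatureAlong_normal_sub_mem_range (hGW : GaussWeingarten nabla f τ ν nab h A D)
    (hs : IsSplitting g gN f τ ν) (hnab : IsConnectionAlong f nab)
    (u v : TangentSpace (𝓡 2) x) (ξ : V x) :
    curvatureAlong nab (FiberBundle.extend (R 2) u) (FiberBundle.extend (R 2) v)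
        (fun y ↦ ν y (FiberBundle.extend (R 2) ξ y)) x
        - ν x (curvature D x u v ξ - (h x u (A x ξ v) - h x v (A x ξ u)))
      ∈ LinearMap.range (τ x).toLinearMap := by
  have hu := (eventually_smoothSectionAt_extend (I := 𝓡 2) (F := R 2) u).self_of_nhds
  have hv := (eventually_smoothSectionAt_extend (I := 𝓡 2) (F := R 2) v).self_of_nhds
  have hξ := eventually_smoothSectionAt_extend (I := 𝓡 2) (F := R 2) ξ
  let w := VectorField.mlieBracket (𝓡 2) (FiberBundle.extend (R 2) u) (FiberBundle.extend (R 2) v) x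
  have bracket : nab (fun y ↦ ν y (FiberBundle.extend (R 2) ξ y)) x w
      - ν x (D (FiberBundle.extend (R 2) ξ) x w) ∈ LinearMap.range (τ x).toLinearMap :=
    ⟨- A x ξ w, by simp [hGW.weingarten _ x hξ.self_of_nhds]⟩
  convert sub_mem (sub_mem (hGW.nab_nab_normal_sub_mem_range hs hnab hξ hv u)
    (hGW.nab_nab_normal_sub_mem_range hs hnab hξ hu v)) bracket using 1
  simp only [curvatureAlong, curvature, curvatureField, FiberBundle.extend_apply_self, map_sub, w]
  abel

theorem shape_apply (hGW : GaussWeingarten nabla f τ ν nab h A D)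
    (hg : IsSemiRiemannianMetric g) (hs : IsSplitting g gN f τ ν)
    (hnab : IsKaehlerConnectionAlong gN J f τ nab) (u v : TangentSpace (𝓡 2) x) (ξ : V x) :
    g x (A x ξ u) v = gN (f x) (ν x (h x u v)) (ν x ξ) := by
  have hv := (eventually_smoothSectionAt_extend (I := 𝓡 2) (F := R 2) v).self_of_nhds
  have hξ := (eventually_smoothSectionAt_extend (I := 𝓡 2) (F := R 2) ξ).self_of_nhds
  have metric := hnab.metric _ _ x (hs.smooth_tangent _ x hv) (hs.smooth_normal _ x hξ) u
  simp only [hs.orthogonal] at metric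
  rw [mvfderiv_const, hGW.gauss _ x hv, hGW.weingarten _ x hξ] at metric
  simp only [FiberBundle.extend_apply_self, map_add, map_neg, add_apply, hs.orthogonal,
    hs.isometric, zero_apply] at metric
  rw [hg.symm]
  linarith

theorem gaussEquationAt_iff (hGW : GaussWeingarten nabla f τ ν nab h A D)
    (hg : IsSemiRiemannianMetric g) (hnabla : IsLeviCivita g nabla)
    (hgN : IsSemiRiemannianMetric gN) (hs : IsSplitting g gN f τ ν)
    (hnab : IsKaehlerConnectionAlong gN J f τ nab) :
    GaussEquationAt g nabla gN nablaN f τ ν h x ↔ ∀ u v z w : TangentSpace (𝓡 2) x,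
      gN (f x) (curvatureAlong nab (FiberBundle.extend (R 2) u) (FiberBundle.extend (R 2) v)
          (fun y ↦ τ y (FiberBundle.extend (R 2) z y)) x) (τ x w)
        = gN (f x) (curvature nablaN (f x) (τ x u) (τ x v) (τ x z)) (τ x w) := by
  have normal_tangent (ξ : V x) (w : TangentSpace (𝓡 2) x) : gN (f x) (ν x ξ) (τ x w) = 0 := by
    rw [hgN.symm, hs.orthogonal]
  refine forall₄_congr fun u v z w ↦ ?_
  rw [hGW.curvatureAlong_tangent hnabla hs hnab.toIsConnectionAlong]
  simp only [map_add, add_apply, map_sub, sub_apply, hs.isometric, normal_tangent,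
    hGW.shape_apply hg hs hnab]
  rw [hgN.symm (f x) (ν x (h x u z))]
  constructor <;> intro <;> linarith

theorem ricciEquationAt_iff (hGW : GaussWeingarten nabla f τ ν nab h A D)
    (hg : IsSemiRiemannianMetric g) (hnabla : IsLeviCivita g nabla)
    (hs : IsSplitting g gN f τ ν) (hnab : IsKaehlerConnectionAlong gN J f τ nab) :
    RicciEquationAt g gN nablaN f τ ν A D x ↔ ∀ (u v : TangentSpace (𝓡 2) x) (ξ η : V x),
      gN (f x) (curvatureAlong nab (FiberBundle.extend (R 2) u) (FiberBundle.extend (R 2) v)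
          (fun y ↦ ν y (FiberBundle.extend (R 2) ξ y)) x) (ν x η)
        = gN (f x) (curvature nablaN (f x) (τ x u) (τ x v) (ν x ξ)) (ν x η) := by
  have shape := hGW.shape_apply (x := x) hg hs hnab
  have shape_symm (ζ : V x) (a b) : g x (A x ζ a) b = g x (A x ζ b) a := by
    rw [shape, shape, hGW.secondForm_symm hnabla hs hnab]
  refine forall₄_congr fun u v ξ η ↦ ?_
  have commutator : g x (A x ξ (A x η u) - A x η (A x ξ u)) v
      = gN (f x) (ν x (h x u (A x ξ v))) (ν x η) - gN (f x) (ν x (h x v (A x ξ u))) (ν x η) := by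
    rw [map_sub, sub_apply, shape_symm ξ, hg.symm, shape_symm η (A x ξ u), shape, shape]
  obtain ⟨t, ht⟩ := hGW.curvatureAlong_normal_sub_mem_range hs hnab.toIsConnectionAlong u v ξ
  rw [eq_sub_iff_add_eq, ContinuousLinearMap.coe_coe] at ht
  rw [commutator, ← ht]
  simp only [map_add, map_sub, add_apply, sub_apply, hs.orthogonal]
  constructor <;> intro <;> linarith

end GaussWeingarten

end StructureEquations

section Splitting

section SemiRiemannian

variable {E : Type*} [NormedAddCommGroup E] [NormedSpace ℝ E]
  {H : Type*} [TopologicalSpace H] {I : ModelWithCorners ℝ E H}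
  {M : Type*} [TopologicalSpace M] [ChartedSpace H M] [IsManifold I ∞ M]
  {g : Π x : M, TangentSpace I x →L[ℝ] TangentSpace I x →L[ℝ] ℝ}

theorem IsSemiRiemannianMetric.isSymm_toBilinForm (hg : IsSemiRiemannianMetric g) (x : M) :
    (g x).toBilinForm.IsSymm := ⟨hg.symm x⟩

theorem IsSemiRiemannianMetric.nondegenerate_toBilinForm (hg : IsSemiRiemannianMetric g) (x : M) :
    (g x).toBilinForm.Nondegenerate :=
  (hg.isSymm_toBilinForm x).isRefl.nondegenerate_iff_separatingLeft.2 (hg.nondegenerate x)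

end SemiRiemannian

variable {M : Type*} [TopologicalSpace M] [ChartedSpace (R 2) M] [IsManifold (𝓡 2) ∞ M]
  {N : Type*} [TopologicalSpace N] [ChartedSpace (R 4) N] [IsManifold (𝓡 4) ∞ N]
  {V : M → Type*} [TopologicalSpace (TotalSpace (R 2) V)]
  [∀ x, AddCommGroup (V x)] [∀ x, Module ℝ (V x)] [∀ x, TopologicalSpace (V x)]
  [FiberBundle (R 2) V]
  {g : Π x : M, TangentSpace (𝓡 2) x →L[ℝ] TangentSpace (𝓡 2) x →L[ℝ] ℝ}
  {gN : Π y : N, TangentSpace (𝓡 4) y →L[ℝ] TangentSpace (𝓡 4) y →L[ℝ] ℝ}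
  {f : M → N} {τ : Π x : M, TangentSpace (𝓡 2) x →L[ℝ] TangentSpace (𝓡 4) (f x)}
  {ν : Π x : M, V x →L[ℝ] TangentSpace (𝓡 4) (f x)}

theorem IsSplitting.nondegenerate_comp (hs : IsSplitting g gN f τ ν)
    (hg : IsSemiRiemannianMetric g) (x : M) :
    ((gN (f x)).toBilinForm.comp (τ x).toLinearMap (τ x).toLinearMap).Nondegenerate := by
  have pullback : (gN (f x)).toBilinForm.comp (τ x).toLinearMap (τ x).toLinearMap
      = (g x).toBilinForm := LinearMap.ext₂ (hs.isometric x)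
  rw [pullback]
  exact hg.nondegenerate_toBilinForm x

theorem IsSplitting.exists_apply_notMem_range (hs : IsSplitting g gN f τ ν)
    (hg : IsLorentzMetric g) {J : Π y : N, TangentSpace (𝓡 4) y →L[ℝ] TangentSpace (𝓡 4) y}
    {nablaN : CovariantDerivative (𝓡 4) (R 4) (TangentSpace (𝓡 4) : N → Type _)}
    (hN : IsLorentzianKaehler gN J nablaN) (x : M) :
    ∃ u, J (f x) (τ x u) ∉ LinearMap.range (τ x).toLinearMap :=
  hg.exists_apply_notMem_range x
    (isAlt_compLeft_of_isSkewAdjoint (hN.metric.isSymm_toBilinForm _) (hN.isSkewAdjoint _))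
    (hN.hermitian _) (hs.isometric x)

theorem IsSplitting.eq_zero_of_isSkewAdjoint_of_commute [VectorBundle ℝ (R 2) V]
    (hs : IsSplitting g gN f τ ν) (hg : IsSemiRiemannianMetric g) (hgN : IsSemiRiemannianMetric gN)
    {x : M} {J L : Module.End ℝ (TangentSpace (𝓡 4) (f x))}
    (hJ : (gN (f x)).toBilinForm.IsSkewAdjoint J)
    (hτJ : ∃ u, J (τ x u) ∉ LinearMap.range (τ x).toLinearMap)
    (hL : (gN (f x)).toBilinForm.IsSkewAdjoint L) (hLJ : Commute L J)
    (tangent : ∀ z, L (τ x z) ∈ LinearMap.range (τ x).toLinearMap)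
    (normal : ∀ ξ η, gN (f x) (L (ν x ξ)) (ν x η) = 0) : L = 0 := by
  have finrank_tangent : Module.finrank ℝ (TangentSpace (𝓡 2) x) = 2 :=
    finrank_euclideanSpace_fin (𝕜 := ℝ) (n := 2)
  have finrank_ambient : Module.finrank ℝ (TangentSpace (𝓡 4) (f x)) = 4 :=
    finrank_euclideanSpace_fin (𝕜 := ℝ) (n := 4)
  have finrank_normal : Module.finrank ℝ (V x) = 2 :=
    (VectorBundle.continuousLinearEquivAt ℝ (R 2) V x).toLinearEquiv.finrank_eq.trans
      finrank_euclideanSpace_fin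
  have : FiniteDimensional ℝ (TangentSpace (𝓡 4) (f x)) := .of_finrank_pos (by omega)
  have hG_symm := hgN.isSymm_toBilinForm (f x)
  have hG := hgN.nondegenerate_toBilinForm (f x)
  have hτ := hs.nondegenerate_comp hg x
  have hτ_inj := injective_of_nondegenerate_comp hτ
  have normal_range := range_eq_orthogonal_range hG hτ_inj (hs.injective x) (hs.orthogonal x)
    (by omega)
  refine LorentzKaehler.eq_zero_of_isSkewAdjoint_of_commute hG hG_symm
    (T := LinearMap.range (τ x).toLinearMap) ?_
    (isCompl_range_orthogonal hG_symm.isRefl hτ).codisjoint hJ ?_ hL hLJ ?_ ?_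
  · rw [LinearMap.finrank_range_of_inj hτ_inj, finrank_tangent]
  · obtain ⟨u, hu⟩ := hτJ
    exact fun invariant ↦ hu (invariant ⟨u, rfl⟩)
  · rintro _ ⟨z, rfl⟩
    exact tangent z
  · rw [← normal_range]
    rintro _ ⟨ξ, rfl⟩ _ ⟨η, rfl⟩
    exact normal ξ η

end Splitting

section CurvatureOperators

theorem IsCompatibleConnectionAlong.exists_curvature_eq {E : Type*} [NormedAddCommGroup E]
    [NormedSpace ℝ E] [CompleteSpace E] {H : Type*} [TopologicalSpace H]
    {I : ModelWithCorners ℝ E H}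
    {N : Type*} [TopologicalSpace N] [ChartedSpace H N] [IsManifold I ∞ N]
    {g : Π y : N, TangentSpace I y →L[ℝ] TangentSpace I y →L[ℝ] ℝ}
    {J : Π y : N, TangentSpace I y →L[ℝ] TangentSpace I y}
    {nabla : CovariantDerivative I E (TangentSpace I : N → Type _)}
    (hnabla : IsCompatibleConnectionAlong I I E g J (fun y ↦ y) nabla)
    (hg : IsSemiRiemannianMetric g)
    (hJ : ContMDiff I (I.prod 𝓘(ℝ, E →L[ℝ] E)) ∞ (fun y ↦ TotalSpace.mk' (E →L[ℝ] E) y (J y)))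
    (y : N) (a b : TangentSpace I y) :
    ∃ L : Module.End ℝ (TangentSpace I y), (∀ c, curvature nabla y a b c = L c) ∧
      (g y).toBilinForm.IsSkewAdjoint L ∧ Commute L (J y).toLinearMap := by
  have extend_smooth (c : TangentSpace I y) :=
    eventually_smoothSectionAt_extend (I := I) (F := E) c
  obtain ⟨L, curvature_eq, hL⟩ := hnabla.exists_curvatureEnd contMDiff_id hg.smooth
    (hg.nondegenerate y) hJ (extend_smooth a).self_of_nhds (extend_smooth b).self_of_nhds
  exact ⟨L, fun c ↦ (curvature_eq _ (extend_smooth c)).trans (by simp), hL⟩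

variable {M : Type*} [TopologicalSpace M] [ChartedSpace (R 2) M] [IsManifold (𝓡 2) ∞ M]
  {N : Type*} [TopologicalSpace N] [ChartedSpace (R 4) N] [IsManifold (𝓡 4) ∞ N]
  {V : M → Type*} [TopologicalSpace (TotalSpace (R 2) V)]
  [∀ x, AddCommGroup (V x)] [∀ x, Module ℝ (V x)] [∀ x, TopologicalSpace (V x)]
  [FiberBundle (R 2) V] [VectorBundle ℝ (R 2) V] [ContMDiffVectorBundle ∞ (R 2) V (𝓡 2)]
  {g : Π x : M, TangentSpace (𝓡 2) x →L[ℝ] TangentSpace (𝓡 2) x →L[ℝ] ℝ}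
  {gN : Π y : N, TangentSpace (𝓡 4) y →L[ℝ] TangentSpace (𝓡 4) y →L[ℝ] ℝ}
  {J : Π y : N, TangentSpace (𝓡 4) y →L[ℝ] TangentSpace (𝓡 4) y}
  {f : M → N} {τ : Π x : M, TangentSpace (𝓡 2) x →L[ℝ] TangentSpace (𝓡 4) (f x)}
  {ν : Π x : M, V x →L[ℝ] TangentSpace (𝓡 4) (f x)}
  {nab : (Π x : M, TangentSpace (𝓡 4) (f x)) →
    Π x : M, TangentSpace (𝓡 2) x →L[ℝ] TangentSpace (𝓡 4) (f x)}

theorem IsSplitting.exists_curvatureAlong_eq (hs : IsSplitting g gN f τ ν)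
    (hgN : IsSemiRiemannianMetric gN)
    (hJ : ContMDiff (𝓡 4) ((𝓡 4).prod 𝓘(ℝ, R 4 →L[ℝ] R 4)) ∞
      (fun y ↦ TotalSpace.mk' (R 4 →L[ℝ] R 4) y (J y)))
    (hnab : IsCompatibleConnectionAlong (𝓡 2) (𝓡 4) (R 4) gN J f nab) (x : M)
    (u v : TangentSpace (𝓡 2) x) :
    ∃ L : Module.End ℝ (TangentSpace (𝓡 4) (f x)),
      (∀ z : TangentSpace (𝓡 2) x,
        curvatureAlong nab (FiberBundle.extend (R 2) u) (FiberBundle.extend (R 2) v)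
          (fun y ↦ τ y (FiberBundle.extend (R 2) z y)) x = L (τ x z)) ∧
      (∀ ξ : V x,
        curvatureAlong nab (FiberBundle.extend (R 2) u) (FiberBundle.extend (R 2) v)
          (fun y ↦ ν y (FiberBundle.extend (R 2) ξ y)) x = L (ν x ξ)) ∧
      (gN (f x)).toBilinForm.IsSkewAdjoint L ∧ Commute L (J (f x)).toLinearMap := by
  have extend_smooth (z : TangentSpace (𝓡 2) x) :=
    eventually_smoothSectionAt_extend (I := 𝓡 2) (F := R 2) z
  obtain ⟨L, curvature_eq, hL⟩ := hnab.exists_curvatureEnd hs.smooth_map hgN.smooth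
    (hgN.nondegenerate (f x)) hJ (extend_smooth u).self_of_nhds (extend_smooth v).self_of_nhds
  refine ⟨L, fun z ↦ ?_, fun ξ ↦ ?_, hL⟩
  · rw [curvature_eq _ ((extend_smooth z).mono fun y ↦ hs.smooth_tangent _ y),
      FiberBundle.extend_apply_self]
  · rw [curvature_eq _ ((eventually_smoothSectionAt_extend ξ).mono fun y ↦ hs.smooth_normal _ y),
      FiberBundle.extend_apply_self]

end CurvatureOperators

end LorentzKaehler

open LorentzKaehler in
theorem theorem2_general
    {M : Type*} [TopologicalSpace M] [ChartedSpace (R 2) M] [IsManifold (𝓡 2) ∞ M]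
    {N : Type*} [TopologicalSpace N] [ChartedSpace (R 4) N] [IsManifold (𝓡 4) ∞ N]
    {V : M → Type*} [TopologicalSpace (TotalSpace (R 2) V)]
    [∀ x, AddCommGroup (V x)] [∀ x, Module ℝ (V x)] [∀ x, TopologicalSpace (V x)]
    [∀ x, IsTopologicalAddGroup (V x)] [∀ x, ContinuousSMul ℝ (V x)]
    [FiberBundle (R 2) V] [VectorBundle ℝ (R 2) V] [ContMDiffVectorBundle ∞ (R 2) V (𝓡 2)]
    {g : Π x : M, TangentSpace (𝓡 2) x →L[ℝ] TangentSpace (𝓡 2) x →L[ℝ] ℝ}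
    {nabla : CovariantDerivative (𝓡 2) (R 2) (TangentSpace (𝓡 2) : M → Type _)}
    (hg : IsSemiRiemannianMetric g) (hnabla : IsLeviCivita g nabla)
    {gN : Π y : N, TangentSpace (𝓡 4) y →L[ℝ] TangentSpace (𝓡 4) y →L[ℝ] ℝ}
    {J : Π y : N, TangentSpace (𝓡 4) y →L[ℝ] TangentSpace (𝓡 4) y}
    {nablaN : CovariantDerivative (𝓡 4) (R 4) (TangentSpace (𝓡 4) : N → Type _)}
    (hgN : IsSemiRiemannianMetric gN)
    (hJ : ContMDiff (𝓡 4) ((𝓡 4).prod 𝓘(ℝ, R 4 →L[ℝ] R 4)) ∞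
      (fun y ↦ TotalSpace.mk' (R 4 →L[ℝ] R 4) y (J y)))
    (hJ_skew : ∀ y, (gN y).toBilinForm.IsSkewAdjoint (J y).toLinearMap)
    (hnablaN : IsCompatibleConnectionAlong (𝓡 4) (𝓡 4) (R 4) gN J (fun y ↦ y) nablaN)
    {f : M → N} {τ : Π x : M, TangentSpace (𝓡 2) x →L[ℝ] TangentSpace (𝓡 4) (f x)}
    {ν : Π x : M, V x →L[ℝ] TangentSpace (𝓡 4) (f x)} (hs : IsSplitting g gN f τ ν)
    {nab : (Π x : M, TangentSpace (𝓡 4) (f x)) →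
      Π x : M, TangentSpace (𝓡 2) x →L[ℝ] TangentSpace (𝓡 4) (f x)}
    (hnab : IsKaehlerConnectionAlong gN J f τ nab)
    {h : Π x : M, TangentSpace (𝓡 2) x →L[ℝ] TangentSpace (𝓡 2) x →L[ℝ] V x}
    {A : Π x : M, V x →L[ℝ] TangentSpace (𝓡 2) x →L[ℝ] TangentSpace (𝓡 2) x}
    {D : CovariantDerivative (𝓡 2) (R 2) V} (hGW : GaussWeingarten nabla f τ ν nab h A D) {x : M}
    (hτJ : ∃ u, J (f x) (τ x u) ∉ LinearMap.range (τ x).toLinearMap)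
    (hC : CodazziEquationAt nabla nablaN f τ ν h D x)
    (hR : RicciEquationAt g gN nablaN f τ ν A D x) :
    GaussEquationAt g nabla gN nablaN f τ ν h x := by
  refine (hGW.gaussEquationAt_iff hg hnabla hgN hs hnab).2 fun u v z w ↦ ?_
  obtain ⟨L, hL_tangent, hL_normal, hL, hLJ⟩ :=
    hs.exists_curvatureAlong_eq hgN hJ hnab.isCompatibleConnectionAlong x u v
  obtain ⟨L', hL', hL'_skew, hL'J⟩ := hnablaN.exists_curvature_eq hgN hJ (f x) (τ x u) (τ x v)
  have skew : L - L' ∈ (gN (f x)).toBilinForm.skewAdjointSubmodule := sub_mem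
    (LinearMap.mem_skewAdjointSubmodule _ |>.2 hL)
    (LinearMap.mem_skewAdjointSubmodule _ |>.2 hL'_skew)
  have difference : L - L' = 0 := by
    refine hs.eq_zero_of_isSkewAdjoint_of_commute hg hgN (hJ_skew _) hτJ
      (LinearMap.mem_skewAdjointSubmodule _ |>.1 skew) (hLJ.sub_left hL'J) ?_ ?_
    · intro z
      simpa only [LinearMap.sub_apply, ← hL_tangent, ← hL'] using
        (hGW.codazziEquationAt_iff hnabla hs hnab.toIsConnectionAlong).1 hC u v z
    · intro ξ η
      rw [LinearMap.sub_apply, map_sub, sub_apply, ← hL_normal, ← hL', sub_eq_zero]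
      exact (hGW.ricciEquationAt_iff hg hnabla hs hnab).1 hR u v ξ η
  rw [hL_tangent, hL', sub_eq_zero.1 difference]

open LorentzKaehler in
/-- First part: Lorentz surfaces isometrically immersed by `f` in a Lorentzian Kaehler surface.
Second part: formal solutions, that is, a second fundamental form, a shape operator and a normal
connection that come from an arbitrary Kaehler connection on `f^*TN = TM ⊕ V`, so that none of the
three equations holds automatically. -/
theorem theorem2
    {M : Type*} [TopologicalSpace M] [ChartedSpace (R 2) M] [IsManifold (𝓡 2) ∞ M]
    {N : Type*} [TopologicalSpace N] [ChartedSpace (R 4) N] [IsManifold (𝓡 4) ∞ N]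
    {V : M → Type*} [TopologicalSpace (TotalSpace (R 2) V)]
    [∀ x, AddCommGroup (V x)] [∀ x, Module ℝ (V x)] [∀ x, TopologicalSpace (V x)]
    [∀ x, IsTopologicalAddGroup (V x)] [∀ x, ContinuousSMul ℝ (V x)]
    [FiberBundle (R 2) V] [VectorBundle ℝ (R 2) V] [ContMDiffVectorBundle ∞ (R 2) V (𝓡 2)]
    (g : Π x : M, TangentSpace (𝓡 2) x →L[ℝ] TangentSpace (𝓡 2) x →L[ℝ] ℝ)
    (nabla : CovariantDerivative (𝓡 2) (R 2) (TangentSpace (𝓡 2) : M → Type _))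
    (hg : IsLorentzMetric g) (hnabla : IsLeviCivita g nabla)
    (gN : Π y : N, TangentSpace (𝓡 4) y →L[ℝ] TangentSpace (𝓡 4) y →L[ℝ] ℝ)
    (J : Π y : N, TangentSpace (𝓡 4) y →L[ℝ] TangentSpace (𝓡 4) y)
    (nablaN : CovariantDerivative (𝓡 4) (R 4) (TangentSpace (𝓡 4) : N → Type _))
    (hN : IsLorentzianKaehler gN J nablaN)
    (f : M → N)
    (ν : Π x : M, V x →L[ℝ] TangentSpace (𝓡 4) (f x))
    (nab : (Π x : M, TangentSpace (𝓡 4) (f x)) →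
      Π x : M, TangentSpace (𝓡 2) x →L[ℝ] TangentSpace (𝓡 4) (f x))
    (h : Π x : M, TangentSpace (𝓡 2) x →L[ℝ] TangentSpace (𝓡 2) x →L[ℝ] V x)
    (A : Π x : M, V x →L[ℝ] TangentSpace (𝓡 2) x →L[ℝ] TangentSpace (𝓡 2) x)
    (D : CovariantDerivative (𝓡 2) (R 2) V) :
    (IsSplitting g gN f (fun x ↦ mfderiv (𝓡 2) (𝓡 4) f x) ν →
      IsPullbackConnection nablaN f nab →
      GaussWeingarten nabla f (fun x ↦ mfderiv (𝓡 2) (𝓡 4) f x) ν nab h A D →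
      ∀ x : M,
        CodazziEquationAt nabla nablaN f (fun x ↦ mfderiv (𝓡 2) (𝓡 4) f x) ν h D x →
        RicciEquationAt g gN nablaN f (fun x ↦ mfderiv (𝓡 2) (𝓡 4) f x) ν A D x →
        GaussEquationAt g nabla gN nablaN f (fun x ↦ mfderiv (𝓡 2) (𝓡 4) f x) ν h x) ∧
    (∀ τ : Π x : M, TangentSpace (𝓡 2) x →L[ℝ] TangentSpace (𝓡 4) (f x),
      IsSplitting g gN f τ ν →
      IsKaehlerConnectionAlong gN J f τ nab →
      GaussWeingarten nabla f τ ν nab h A D →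
      ∀ x : M,
        CodazziEquationAt nabla nablaN f τ ν h D x →
        RicciEquationAt g gN nablaN f τ ν A D x →
        GaussEquationAt g nabla gN nablaN f τ ν h x) := by
  have main {τ : Π x : M, TangentSpace (𝓡 2) x →L[ℝ] TangentSpace (𝓡 4) (f x)}
      (hs : IsSplitting g gN f τ ν) (hnab : IsKaehlerConnectionAlong gN J f τ nab)
      (hGW : GaussWeingarten nabla f τ ν nab h A D) (x : M) :=
    theorem2_general hg.toIsSemiRiemannianMetric hnabla hN.metric hN.smooth hN.isSkewAdjoint
      hN.isCompatibleConnectionAlong hs hnab hGW (hs.exists_apply_notMem_range hg hN x)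
  exact ⟨fun hs hp ↦ main hs (hp.isKaehlerConnectionAlong hs.smooth_map hN), fun _ ↦ main⟩
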